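/- Let $\Bbbk$ be an algebraically closed field. A finite $\Bbbk$-linear category is an abelian $\Bbbk$-linear category that is $\Bbbk$-linearly equivalent to the category of finite-dimensional modules over a finite-dimensional $\Bbbk$-algebra. Let $\mathcal C$ be a finite tensor category, i.e. a finite $\Bbbk$-linear category with a rigid monoidal structure whose tensor product is $\Bbbk$-bilinear and whose unit object is simple. Let $\mathcal M_1,\mathcal M_2,\mathcal M_3$ be finite module categories over $\mathcal C$, i.e. finite $\Bbbk$-linear categories with a (left) action of $\mathcal C$, written $c.m$, that is $\Bbbk$-bilinear and right exact in each variable. For such module categories $\mathcal M,\mathcal N$, let $\mathcal Rex_{\mathcal C}(\mathcal M,\mathcal N)$ be the category of $\Bbbk$-linear right exact $\mathcal C$-module functors and module natural transformations. Let $\mathcal Z(\mathcal C)$ be the Drinfeld center of $\mathcal C$, with objects $z=(c_0,\beta)$ given by an object $c_0$ of $\mathcal C$ and a natural family of isomorphisms $\beta_c\colon c_0\otimes c\to c\otimes c_0$ compatible with the tensor product of $\mathcal C$. We take as braiding on $\mathcal Z(\mathcal C)$ the one whose component $X\otimes Y\to Y\otimes X$ is the inverse of $\beta^Y_X\colon Y\otimes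 X\to X\otimes Y$, where $\beta^Y$ is the family $\beta$ belonging to $Y$ (equivalently, it is the half-braiding $\sigma_c=\beta_c^{-1}\colon c\otimes c_0\to c_0\otimes c$ of the second factor, evaluated at the first factor). The category $\mathcal Rex_{\mathcal C}(\mathcal M,\mathcal N)$ is a module category over $\mathcal Z(\mathcal C)$: $(z.F)(m)=c_0.F(m)$, with module functor constraint $$c_0.F(c.m)\cong c_0.(c.F(m))\cong(c_0\otimes c).F(m)\xrightarrow{\ \beta_c.\mathrm{id}\ }(c\otimes c_0).F(m)\cong c.(c_0.F(m)).$$ Denote by $\underline{\mathrm{Nat}}(F,G)\in\mathcal Z(\mathcal C)$ the internal Hom of $F,G\in\mathcal Rex_{\mathcal C}(\mathcal M,\mathcal N)$, so that $\mathrm{Hom}_{\mathcal Z(\mathcal C)}(z,\underline{\mathrm{Nat}}(F,G))\cong\mathrm{Hom}(z.F,G)$ naturally in $z$. Equivalently, $$\underline{\mathrm{Nat}}(F,G)=\int^{z\in\mathcal Z(\mathcal C)}\mathrm{Hom}(z.F,G)\otimes_\Bbbk z,$$ with structure morphisms $\imath_z^{F,G}$ that send $\varphi\colon z.F\to G$ to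 the corresponding morphism $z\to\underline{\mathrm{Nat}}(F,G)$. The vertical composition $\underline\mu_{\rm ver}\colon\underline{\mathrm{Nat}}(G,H)\otimes\underline{\mathrm{Nat}}(F,G)\to\underline{\mathrm{Nat}}(F,H)$ is the multiplication of internal Homs, i.e. the morphism that corresponds to $$(\underline{\mathrm{Nat}}(G,H)\otimes\underline{\mathrm{Nat}}(F,G)).F\cong\underline{\mathrm{Nat}}(G,H).(\underline{\mathrm{Nat}}(F,G).F)\xrightarrow{\ \mathrm{id}.\mathrm{ev}\ }\underline{\mathrm{Nat}}(G,H).G\xrightarrow{\ \mathrm{ev}\ }H .$$ For $F,F'\in\mathcal Rex_{\mathcal C}(\mathcal M_1,\mathcal M_2)$ and $G,G'\in\mathcal Rex_{\mathcal C}(\mathcal M_2,\mathcal M_3)$, the horizontal composition $\underline\mu_{\rm hor}\colon\underline{\mathrm{Nat}}(G,G')\otimes\underline{\mathrm{Nat}}(F,F')\to\underline{\mathrm{Nat}}(G\circ F,G'\circ F')$ is the morphism out of the coend $$\underline{\mathrm{Nat}}(G,G')\otimes\underline{\mathrm{Nat}}(F,F')\cong\int^{z,z'\in\mathcal Z(\mathcal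 C)}\mathrm{Hom}(z.G,G')\otimes_\Bbbk\mathrm{Hom}(z'.F,F')\otimes_\Bbbk(z\otimes z')$$ given by the dinatural family that sends $\varphi\colon z.G\to G'$ and $\psi\colon z'.F\to F'$ to $\imath^{G\circ F,G'\circ F'}_{z\otimes z'}$ applied to the composite $$(z\otimes z').(G\circ F)\cong(z.G)\circ(z'.F)\xrightarrow{\ \varphi\circ\psi\ }G'\circ F',$$ where the isomorphism is given by the module category associator and the inverse module functor constraint of $G$, and $\varphi\circ\psi$ is the ordinary horizontal composition of natural transformations. Then for all $F,G,H\in\mathcal Rex_{\mathcal C}(\mathcal M_1,\mathcal M_2)$ and all $F',G',H'\in\mathcal Rex_{\mathcal C}(\mathcal M_2,\mathcal M_3)$ the vertical and the horizontal composition satisfy the Eckmann–Hilton interchange law $$\underline\mu_{\rm ver}\circ(\underline\mu_{\rm hor}\otimes\underline\mu_{\rm hor})=\underline\mu_{\rm hor}\circ(\underline\mu_{\rm ver}\otimes\underline\mu_{\rm ver})\circ(\mathrm{id}\otimes c\otimes\mathrm{id})$$ of morphisms $$\underline{\mathrm{Nat}}(G',H')\otimes\underline{\mathrm{Nat}}(G,H)\otimes\underline{\mathrm{Nat}}(F',G')\otimes\underline{\mathrm{Nat}}(F,G)\longrightarrow\underline{\mathrm{Nat}}(F'\circ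 F,H'\circ H)$$ in $\mathcal Z(\mathcal C)$, where $c\colon\underline{\mathrm{Nat}}(G,H)\otimes\underline{\mathrm{Nat}}(F',G')\to\underline{\mathrm{Nat}}(F',G')\otimes\underline{\mathrm{Nat}}(G,H)$ is the braiding of $\mathcal Z(\mathcal C)$ (associators are suppressed). -/

import Mathlib

open CategoryTheory MonoidalCategory Limits
open scoped MonoidalLeftAction

universe w v u v₁ u₁ v₂ u₂ v₃ u₃

set_option linter.unusedSectionVars false

noncomputable section

namespace InternalNat

open Functor.LaxLeftLinear Functor.OplaxLeftLinear

/-- A finite `k`-linear category: an abelian `k`-linear category which is `k`-linearly equivalent to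
the category of finite-dimensional modules over a finite-dimensional `k`-algebra. -/
class FiniteLinearCategory (k : Type w) [Field k] (D : Type u) [Category.{v} D] [Abelian D]
    [Linear k D] : Prop where
  exists_equivalence : ∃ (A : Type w) (_ : Ring A) (_ : Algebra k A) (_ : Module.Finite k A)
    (e : D ≌ FGModuleCat.{w} A), e.functor.Additive ∧ e.functor.Linear k

/-- A finite tensor category: a finite `k`-linear category with a rigid monoidal structure whose
tensor product is `k`-bilinear and whose unit object is simple. -/
class FiniteTensorCategory (k : Type w) [Field k] (C : Type u) [Category.{v} C] [Abelian C]
    [Linear k C] [MonoidalCategory C] [RigidCategory C] : Prop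
    extends FiniteLinearCategory k C, MonoidalPreadditive C, MonoidalLinear k C where
  simple_unit : Simple (𝟙_ C)

/-- A finite module category over `C`: a finite `k`-linear category with an action of `C` that is
`k`-bilinear and right exact in each variable. -/
class FiniteModuleCategory (k : Type w) [Field k] (C : Type u) [Category.{v} C] [Abelian C]
    [Linear k C] [MonoidalCategory C] (M : Type u₁) [Category.{v₁} M] [Abelian M] [Linear k M]
    [MonoidalLeftAction C M] : Prop extends FiniteLinearCategory k M where
  additive_actionLeft (c : C) : (MonoidalLeftAction.actionLeft M c).Additive
  linear_actionLeft (c : C) : (MonoidalLeftAction.actionLeft M c).Linear k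
  rightExact_actionLeft (c : C) : PreservesFiniteColimits (MonoidalLeftAction.actionLeft M c)
  additive_actionRight (m : M) : (MonoidalLeftAction.actionRight C m).Additive
  linear_actionRight (m : M) : (MonoidalLeftAction.actionRight C m).Linear k
  rightExact_actionRight (m : M) : PreservesFiniteColimits (MonoidalLeftAction.actionRight C m)

/-! ### The linear structure of the Drinfeld center -/

section Center

variable {C : Type u} [Category.{v} C] [MonoidalCategory C] [Preadditive C] [MonoidalPreadditive C]

instance (X Y : Center C) : Zero (X ⟶ Y) := ⟨⟨0, fun U => by simp⟩⟩
instance (X Y : Center C) : Add (X ⟶ Y) := ⟨fun f g => ⟨f.f + g.f, fun U => by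
  simp [MonoidalPreadditive.add_whiskerRight, MonoidalPreadditive.whiskerLeft_add]⟩⟩
instance (X Y : Center C) : Neg (X ⟶ Y) := ⟨fun f => ⟨-f.f, fun U => by
  have h : (-f.f) ▷ U = -(f.f ▷ U) := (tensorRight U).map_neg (f := f.f)
  have h' : U ◁ (-f.f) = -(U ◁ f.f) := (tensorLeft U).map_neg (f := f.f)
  rw [h, h', Preadditive.neg_comp, Preadditive.comp_neg, f.comm]⟩⟩

@[simp] lemma center_zero_f (X Y : Center C) : (0 : X ⟶ Y).f = 0 := rfl
@[simp] lemma center_add_f {X Y : Center C} (f g : X ⟶ Y) : (f + g).f = f.f + g.f := rfl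
@[simp] lemma center_neg_f {X Y : Center C} (f : X ⟶ Y) : (-f).f = -f.f := rfl

instance (X Y : Center C) : AddCommGroup (X ⟶ Y) where
  add_assoc f g h := by ext; simp [add_assoc]
  zero_add f := by ext; simp
  add_zero f := by ext; simp
  add_comm f g := by ext; simp [add_comm]
  neg_add_cancel f := by ext; simp
  nsmul := nsmulRec
  zsmul := zsmulRec

instance : Preadditive (Center C) where
  add_comp X Y Z f g h := by ext; simp
  comp_add X Y Z f g h := by ext; simp

variable (k : Type w) [Field k] [Linear k C] [MonoidalLinear k C]

instance (X Y : Center C) : SMul k (X ⟶ Y) := ⟨fun a f => ⟨a • f.f, fun U => by simp⟩⟩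

variable {k} in
@[simp] lemma center_smul_f {X Y : Center C} (a : k) (f : X ⟶ Y) : (a • f).f = a • f.f := rfl

instance (X Y : Center C) : Module k (X ⟶ Y) where
  one_smul f := by ext; simp
  mul_smul a b f := by ext; simp [mul_smul]
  smul_zero a := by ext; simp
  smul_add a f g := by ext; simp
  add_smul a b f := by ext; simp [add_smul]
  zero_smul f := by ext; simp

instance : Linear k (Center C) where
  smul_comp X Y Z a f g := by ext; simp
  comp_smul X Y Z f a g := by ext; simp

/-- The braiding `X ⊗ Y ≅ Y ⊗ X` of the Drinfeld center. An object of Mathlib's `Center C` is an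
object `x` with isomorphisms `β_c : x ⊗ c ≅ c ⊗ x`. Equivalently, it carries the half-braiding
`σ_c = (β_c)⁻¹ : c ⊗ x ≅ x ⊗ c`, and the braiding of the center is the half-braiding `σ` of the second
object, evaluated at the first object: `X ⊗ Y ⟶ Y ⊗ X` is the inverse of the `β` of `Y` at `X`. This
is the inverse of Mathlib's `β_ Y X`. -/
def centerBraiding {C : Type u} [Category.{v} C] [MonoidalCategory C] (X Y : Center C) :
    X ⊗ Y ≅ Y ⊗ X := (β_ Y X).symm

lemma centerBraiding_hom_f {C : Type u} [Category.{v} C] [MonoidalCategory C] (X Y : Center C) :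
  (centerBraiding X Y).hom.f = (Y.2.β X.1).inv := by
  have := (β_ Y X).hom_inv_id
  have h := congrArg Center.Hom.f this
  rw [Center.comp_f] at h
  change (Y.2.β X.1).hom ≫ _ = _ at h
  exact (Iso.eq_inv_comp _ |>.2 h).trans (by simp)

end Center

/-! ### Bilinearity of the action, in terms of morphisms -/

section Bilinear

variable {C : Type u} [Category.{v} C] [Abelian C] [MonoidalCategory C]
  {N : Type u₂} [Category.{v₂} N] [Abelian N] [MonoidalLeftAction C N]

lemma act_add (k : Type w) [Field k] [Linear k C] [Linear k N] [FiniteModuleCategory k C N]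
    (c : C) {n n' : N} (f g : n ⟶ n') : c ⊴ₗ (f + g) = c ⊴ₗ f + c ⊴ₗ g :=
  (FiniteModuleCategory.additive_actionLeft (k := k) (C := C) (M := N) c).map_add

lemma act_zero (k : Type w) [Field k] [Linear k C] [Linear k N] [FiniteModuleCategory k C N]
    (c : C) (n n' : N) : c ⊴ₗ (0 : n ⟶ n') = 0 :=
  haveI := FiniteModuleCategory.additive_actionLeft (k := k) (C := C) (M := N) c
  (MonoidalLeftAction.actionLeft N c).map_zero n n'

lemma act_neg (k : Type w) [Field k] [Linear k C] [Linear k N] [FiniteModuleCategory k C N]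
    (c : C) {n n' : N} (f : n ⟶ n') : c ⊴ₗ (-f) = -(c ⊴ₗ f) :=
  haveI := FiniteModuleCategory.additive_actionLeft (k := k) (C := C) (M := N) c
  (MonoidalLeftAction.actionLeft N c).map_neg

lemma act_smul (k : Type w) [Field k] [Linear k C] [Linear k N] [FiniteModuleCategory k C N]
    (c : C) {n n' : N} (a : k) (f : n ⟶ n') : c ⊴ₗ (a • f) = a • c ⊴ₗ f :=
  (FiniteModuleCategory.linear_actionLeft (k := k) (C := C) (M := N) c).map_smul f a

lemma add_act (k : Type w) [Field k] [Linear k C] [Linear k N] [FiniteModuleCategory k C N]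
    {c c' : C} (f g : c ⟶ c') (n : N) : (f + g) ⊵ₗ n = f ⊵ₗ n + g ⊵ₗ n :=
  (FiniteModuleCategory.additive_actionRight (k := k) (C := C) (M := N) n).map_add

lemma smul_act (k : Type w) [Field k] [Linear k C] [Linear k N] [FiniteModuleCategory k C N]
    {c c' : C} (a : k) (f : c ⟶ c') (n : N) : (a • f) ⊵ₗ n = a • f ⊵ₗ n :=
  (FiniteModuleCategory.linear_actionRight (k := k) (C := C) (M := N) n).map_smul f a

lemma zero_act (k : Type w) [Field k] [Linear k C] [Linear k N] [FiniteModuleCategory k C N]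
    (c c' : C) (n : N) : (0 : c ⟶ c') ⊵ₗ n = 0 :=
  haveI := FiniteModuleCategory.additive_actionRight (k := k) (C := C) (M := N) n
  (MonoidalLeftAction.actionRight C n).map_zero c c'

end Bilinear

section Rex

/-! ### Right exact module functors -/

/-- A natural family of isomorphisms `F (c . m) ≅ c . F m` compatible with the mixed associators
and unitors makes `F` a module functor. -/
@[reducible]
def leftLinearOfIso {C : Type u} [Category.{v} C] [MonoidalCategory C] {M : Type u₁}
    [Category.{v₁} M] [MonoidalLeftAction C M] {N : Type u₂} [Category.{v₂} N]
    [MonoidalLeftAction C N] (F : M ⥤ N) (e : ∀ (c : C) (m : M), F.obj (c ⊙ₗ m) ≅ c ⊙ₗ F.obj m)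
    (nat_left : ∀ {c c' : C} (f : c ⟶ c') (m : M),
      F.map (f ⊵ₗ m) ≫ (e c' m).hom = (e c m).hom ≫ f ⊵ₗ F.obj m)
    (nat_right : ∀ (c : C) {m m' : M} (f : m ⟶ m'),
      F.map (c ⊴ₗ f) ≫ (e c m').hom = (e c m).hom ≫ c ⊴ₗ F.map f)
    (assoc : ∀ (c c' : C) (m : M), (e (c ⊗ c') m).hom ≫ (αₗ c c' (F.obj m)).hom =
      F.map (αₗ c c' m).hom ≫ (e c (c' ⊙ₗ m)).hom ≫ c ⊴ₗ (e c' m).hom)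
    (unit : ∀ m : M, (e (𝟙_ C) m).hom ≫ (λₗ (F.obj m)).hom = F.map (λₗ m).hom) :
    F.LeftLinear C where
  μₗ c m := (e c m).inv
  δₗ c m := (e c m).hom
  μₗ_naturality_left f m := by
    rw [Iso.eq_inv_comp, ← Category.assoc, Iso.comp_inv_eq, nat_left]
  μₗ_naturality_right c _ _ f := by
    rw [Iso.eq_inv_comp, ← Category.assoc, Iso.comp_inv_eq, nat_right]
  μₗ_associativity c c' m := by
    rw [Iso.inv_comp_eq, ← cancel_mono (e c (c' ⊙ₗ m)).hom, ← cancel_mono (c ⊴ₗ (e c' m).hom)]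
    have h := assoc c c' m
    simp only [Category.assoc] at h ⊢
    rw [← h, Iso.inv_hom_id_assoc, MonoidalLeftAction.actionHomRight_inv_hom, Category.comp_id]
  μₗ_unitality m := by rw [Iso.eq_inv_comp, unit]
  δₗ_naturality_left := nat_left
  δₗ_naturality_right := nat_right
  δₗ_associativity := assoc
  δₗ_unitality_inv m := by
    have h := unit m
    rw [← Iso.eq_comp_inv] at h
    rw [h, ← Category.assoc, ← F.map_comp, Iso.inv_hom_id, F.map_id, Category.id_comp]
  μₗ_comp_δₗ c m := (e c m).inv_hom_id
  δₗ_comp_μₗ c m := (e c m).hom_inv_id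

variable (k : Type w) [Field k] (C : Type u) [Category.{v} C] [MonoidalCategory C]
  (M : Type u₁) [Category.{v₁} M] [Abelian M] [Linear k M] [MonoidalLeftAction C M]
  (N : Type u₂) [Category.{v₂} N] [Abelian N] [Linear k N] [MonoidalLeftAction C N]
  (P : Type u₃) [Category.{v₃} P] [Abelian P] [Linear k P] [MonoidalLeftAction C P]

/-- Right exact `k`-linear `C`-module functors from `M` to `N`. The isomorphism
`δₗ : F (c . m) ⟶ c . F m`, with inverse `μₗ`, is the module functor constraint. -/
structure RexFunctor where
  toFunctor : M ⥤ N
  [leftLinear : toFunctor.LeftLinear C]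
  [additive : toFunctor.Additive]
  [linear : toFunctor.Linear k]
  [rightExact : PreservesFiniteColimits toFunctor]

attribute [instance] RexFunctor.leftLinear RexFunctor.additive RexFunctor.linear
  RexFunctor.rightExact

variable {k C M N P}

namespace RexFunctor

/-- The value of a module functor on an object. -/
abbrev obj (F : RexFunctor k C M N) (m : M) : N := F.toFunctor.obj m

/-- The value of a module functor on a morphism. -/
abbrev map (F : RexFunctor k C M N) {m m' : M} (f : m ⟶ m') : F.obj m ⟶ F.obj m' :=
  F.toFunctor.map f

/-- The module functor constraint `F (c . m) ≅ c . F m`. -/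
@[simps]
def φ (F : RexFunctor k C M N) (c : C) (m : M) : F.obj (c ⊙ₗ m) ≅ c ⊙ₗ F.obj m where
  hom := δₗ F.toFunctor c m
  inv := μₗ F.toFunctor c m

/-- Module natural transformations. -/
@[ext]
structure Hom (F G : RexFunctor k C M N) where
  nat : F.toFunctor ⟶ G.toFunctor
  comm (c : C) (m : M) :
    δₗ F.toFunctor c m ≫ c ⊴ₗ nat.app m = nat.app (c ⊙ₗ m) ≫ δₗ G.toFunctor c m

/-- The category `Rex_C(M, N)`. -/
instance : Category (RexFunctor k C M N) where
  Hom := Hom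
  id F := { nat := 𝟙 _, comm := fun c m => by simp }
  comp f g := { nat := f.nat ≫ g.nat, comm := fun c m => by simp [reassoc_of% f.comm, g.comm] }

/-- The component at `m` of a module natural transformation. -/
abbrev app {F G : RexFunctor k C M N} (f : F ⟶ G) (m : M) : F.obj m ⟶ G.obj m :=
  (Hom.nat f).app m

@[ext]
lemma hom_ext {F G : RexFunctor k C M N} {f g : F ⟶ G} (h : ∀ m, app f m = app g m) : f = g :=
  Hom.ext (NatTrans.ext (funext h))

@[simp] lemma app_id (F : RexFunctor k C M N) (m : M) : app (𝟙 F) m = 𝟙 _ := rfl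
@[simp] lemma app_comp {F G H : RexFunctor k C M N} (f : F ⟶ G) (g : G ⟶ H) (m : M) :
    app (f ≫ g) m = app f m ≫ app g m := rfl
lemma app_naturality {F G : RexFunctor k C M N} (f : F ⟶ G) {m m' : M} (a : m ⟶ m') :
    F.map a ≫ app f m' = app f m ≫ G.map a := (Hom.nat f).naturality a
lemma app_comm {F G : RexFunctor k C M N} (f : F ⟶ G) (c : C) (m : M) :
    δₗ F.toFunctor c m ≫ c ⊴ₗ app f m = app f (c ⊙ₗ m) ≫ δₗ G.toFunctor c m := Hom.comm f c m

/-- Constructor for module natural transformations. -/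
def mkHom {F G : RexFunctor k C M N} (f : ∀ m, F.obj m ⟶ G.obj m)
    (hf : ∀ {m m' : M} (a : m ⟶ m'), F.map a ≫ f m' = f m ≫ G.map a)
    (hf' : ∀ (c : C) (m : M),
      δₗ F.toFunctor c m ≫ c ⊴ₗ f m = f (c ⊙ₗ m) ≫ δₗ G.toFunctor c m) : F ⟶ G :=
  Hom.mk { app := f, naturality := fun _ _ a => hf a } hf'

@[simp] lemma app_mkHom {F G : RexFunctor k C M N} (f : ∀ m, F.obj m ⟶ G.obj m) (hf) (hf') (m : M) :
    app (mkHom (F := F) (G := G) f hf hf') m = f m := rfl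

/-- The composite `G ∘ F` of module functors. -/
def comp (G : RexFunctor k C N P) (F : RexFunctor k C M N) : RexFunctor k C M P where
  toFunctor := F.toFunctor ⋙ G.toFunctor
  leftLinear :=
    { μₗ := fun c m => μₗ G.toFunctor c (F.obj m) ≫ G.map (μₗ F.toFunctor c m)
      μₗ_naturality_left := fun f d => by
        simp [← Functor.map_comp]
      μₗ_naturality_right := fun c _ _ f => by
        simp [← Functor.map_comp]
      μₗ_associativity := fun c c' d => by
        simp only [Functor.comp_map, Category.assoc, MonoidalLeftAction.actionHomRight_comp]
        rw [← Functor.map_comp, μₗ_associativity]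
        simp
      μₗ_unitality := fun d => by
        simp [← Functor.map_comp]
      δₗ := fun c m => G.map (δₗ F.toFunctor c m) ≫ δₗ G.toFunctor c (F.obj m)
      δₗ_naturality_left := fun f d => by
        simp [← Functor.map_comp_assoc]
      δₗ_naturality_right := fun c _ _ f => by
        simp [← Functor.map_comp_assoc]
      δₗ_associativity := fun c c' d => by
        simp only [Functor.comp_map, Functor.comp_obj, Category.assoc,
          MonoidalLeftAction.actionHomRight_comp]
        rw [δₗ_associativity, ← Functor.map_comp_assoc, δₗ_associativity]
        simp
      δₗ_unitality_inv := fun d => by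
        simp only [Functor.comp_map]
        rw [← Functor.map_comp_assoc, ← δₗ_unitality_inv, ← δₗ_unitality_inv]
        rfl
      μₗ_comp_δₗ := fun c m => by
        simp [← Functor.map_comp_assoc]
      δₗ_comp_μₗ := fun c m => by
        simp [← Functor.map_comp] }
  additive := inferInstance
  linear := inferInstance
  rightExact := comp_preservesFiniteColimits _ _

end RexFunctor

/-! ### Moving an object of the center past an object of `C` -/

section Slide

lemma act_pentagon (a b c : C) (n : N) {n' : N} (h : a ⊙ₗ b ⊙ₗ c ⊙ₗ n ⟶ n') :
    (αₗ (a ⊗ b) c n).hom ≫ (αₗ a b (c ⊙ₗ n)).hom ≫ h =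
      (α_ a b c).hom ⊵ₗ n ≫ (αₗ a (b ⊗ c) n).hom ≫ a ⊴ₗ (αₗ b c n).hom ≫ h := by
  have := MonoidalLeftAction.associator_actionHom a b c n
  rw [← reassoc_of% this]

lemma act_pentagon' (a b c : C) (n : N) {n' : N} (h : a ⊙ₗ b ⊙ₗ c ⊙ₗ n ⟶ n') :
    (α_ a b c).inv ⊵ₗ n ≫ (αₗ (a ⊗ b) c n).hom ≫ (αₗ a b (c ⊙ₗ n)).hom ≫ h =
      (αₗ a (b ⊗ c) n).hom ≫ a ⊴ₗ (αₗ b c n).hom ≫ h := by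
  rw [act_pentagon, MonoidalLeftAction.inv_hom_actionHomLeft_assoc]

lemma act_pentagon_inv (a b c : C) (n : N) {n' : N} (h : ((a ⊗ b) ⊗ c) ⊙ₗ n ⟶ n') :
    a ⊴ₗ (αₗ b c n).hom ≫ (αₗ a b (c ⊙ₗ n)).inv ≫ (αₗ (a ⊗ b) c n).inv ≫ h =
      (αₗ a (b ⊗ c) n).inv ≫ (α_ a b c).inv ⊵ₗ n ≫ h := by
  have := act_pentagon' a b c n ((αₗ a b (c ⊙ₗ n)).inv ≫ (αₗ (a ⊗ b) c n).inv ≫ h)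
  rw [Iso.hom_inv_id_assoc, Iso.hom_inv_id_assoc] at this
  rw [this, Iso.inv_hom_id_assoc]

lemma act_pentagon_inv' (a b c : C) (n : N) {n' : N} (h : (a ⊗ b ⊗ c) ⊙ₗ n ⟶ n') :
    (αₗ a b (c ⊙ₗ n)).inv ≫ (αₗ (a ⊗ b) c n).inv ≫ (α_ a b c).hom ⊵ₗ n ≫ h =
      a ⊴ₗ (αₗ b c n).inv ≫ (αₗ a (b ⊗ c) n).inv ≫ h := by
  have := act_pentagon_inv a b c n ((α_ a b c).hom ⊵ₗ n ≫ h)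
  rw [MonoidalLeftAction.inv_hom_actionHomLeft_assoc] at this
  rw [← this, MonoidalLeftAction.actionHomRight_inv_hom_assoc]

lemma center_halfBraiding_unit (z : Center C) :
    (z.2.β (𝟙_ C)).hom ≫ (λ_ z.1).hom = (ρ_ z.1).hom :=
  congrArg Center.Hom.f (braiding_leftUnitor z)

lemma halfBraiding_unit {x : C} (b : HalfBraiding x) :
    (b.β (𝟙_ C)).hom ≫ (λ_ x).hom = (ρ_ x).hom :=
  center_halfBraiding_unit ⟨x, b⟩

/-- The isomorphism `x . (c . n) ≅ (x ⊗ c) . n ≅ (c ⊗ x) . n ≅ c . (x . n)` given by a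
half-braiding of `x` and the mixed associators. -/
@[simps]
def slide {x : C} (b : HalfBraiding x) (c : C) (n : N) : x ⊙ₗ c ⊙ₗ n ≅ c ⊙ₗ x ⊙ₗ n where
  hom := (αₗ x c n).inv ≫ (b.β c).hom ⊵ₗ n ≫ (αₗ c x n).hom
  inv := (αₗ c x n).inv ≫ (b.β c).inv ⊵ₗ n ≫ (αₗ x c n).hom

lemma slide_naturality_left {x : C} (b : HalfBraiding x) {c c' : C} (f : c ⟶ c') (n : N) :
    x ⊴ₗ f ⊵ₗ n ≫ (slide b c' n).hom = (slide b c n).hom ≫ f ⊵ₗ (x ⊙ₗ n) := by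
  have h := congrArg (fun t => t ⊵ₗ n) (b.naturality f)
  simp only [MonoidalLeftAction.comp_actionHomLeft, MonoidalLeftAction.whiskerLeft_actionHomLeft,
    Category.assoc] at h
  rw [← Iso.eq_inv_comp] at h
  simp [reassoc_of% h]

lemma slide_naturality_right {x : C} (b : HalfBraiding x) (c : C) {n n' : N} (g : n ⟶ n') :
    x ⊴ₗ c ⊴ₗ g ≫ (slide b c n').hom = (slide b c n).hom ≫ c ⊴ₗ x ⊴ₗ g := by
  have h := MonoidalLeftAction.action_exchange (b.β c).hom g
  simp only [MonoidalLeftAction.tensor_actionHomRight, Category.assoc] at h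
  rw [← Iso.eq_inv_comp] at h
  simp [reassoc_of% h]

lemma slide_assoc {x : C} (b : HalfBraiding x) (c c' : C) (n : N) :
    (slide b (c ⊗ c') n).hom ≫ (αₗ c c' (x ⊙ₗ n)).hom =
      x ⊴ₗ (αₗ c c' n).hom ≫ (slide b c (c' ⊙ₗ n)).hom ≫ c ⊴ₗ (slide b c' n).hom := by
  have h := act_pentagon' c c' x n (𝟙 _)
  simp only [Category.comp_id] at h
  simp [h, act_pentagon_inv, act_pentagon]

lemma slide_unit {x : C} (b : HalfBraiding x) (n : N) :
    (slide b (𝟙_ C) n).hom ≫ (λₗ (x ⊙ₗ n)).hom = x ⊴ₗ (λₗ n).hom := by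
  have h := congrArg (fun t => t ⊵ₗ n) (halfBraiding_unit b)
  simp only [MonoidalLeftAction.comp_actionHomLeft, MonoidalLeftAction.leftUnitor_actionHom,
    MonoidalLeftAction.rightUnitor_actionHom] at h
  simp [h]

lemma slide_map {x x' : C} {b : HalfBraiding x} {b' : HalfBraiding x'} {f : x ⟶ x'}
    (hf : ∀ c, f ▷ c ≫ (b'.β c).hom = (b.β c).hom ≫ c ◁ f) (c : C) (n : N) :
    f ⊵ₗ (c ⊙ₗ n) ≫ (slide b' c n).hom = (slide b c n).hom ≫ c ⊴ₗ f ⊵ₗ n := by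
  have h := congrArg (fun t => t ⊵ₗ n) (hf c)
  simp only [MonoidalLeftAction.comp_actionHomLeft, MonoidalLeftAction.whiskerLeft_actionHomLeft] at h
  simp [reassoc_of% h]

lemma slide_tensor {x x' : C} {b : HalfBraiding x} {b' : HalfBraiding x'}
    {b'' : HalfBraiding (x ⊗ x')}
    (hb : ∀ c, (b''.β c).hom = (α_ x x' c).hom ≫ x ◁ (b'.β c).hom ≫ (α_ x c x').inv ≫
      (b.β c).hom ▷ x' ≫ (α_ c x x').hom) (c : C) (n : N) :
    (αₗ x x' (c ⊙ₗ n)).hom ≫ x ⊴ₗ (slide b' c n).hom ≫ (slide b c (x' ⊙ₗ n)).hom =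
      (slide b'' c n).hom ≫ c ⊴ₗ (αₗ x x' n).hom := by
  have h : (αₗ (x ⊗ x') c n).inv ≫ (α_ x x' c).hom ⊵ₗ n ≫ (αₗ x (x' ⊗ c) n).hom =
      (αₗ x x' (c ⊙ₗ n)).hom ≫ x ⊴ₗ (αₗ x' c n).inv := by
    rw [Iso.inv_comp_eq, act_pentagon]
    simp
  simp only [slide_hom, hb]
  simp [reassoc_of% h, act_pentagon_inv]

lemma slide_tensorUnit {b : HalfBraiding (𝟙_ C)}
    (hb : ∀ c, (b.β c).hom = (λ_ c).hom ≫ (ρ_ c).inv) (c : C) (n : N) :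
    (slide b c n).hom ≫ c ⊴ₗ (λₗ n).hom = (λₗ (c ⊙ₗ n)).hom := by
  have h := MonoidalLeftAction.leftUnitor_actionHom c n
  have h' := MonoidalLeftAction.rightUnitor_actionHom c n
  simp only [slide_hom, hb, MonoidalLeftAction.comp_actionHomLeft, h, Category.assoc,
    Iso.inv_hom_id_assoc]
  rw [← h', MonoidalLeftAction.inv_hom_actionHomLeft, Category.comp_id]

end Slide

namespace RexFunctor

variable [Abelian C] [Linear k C] [FiniteModuleCategory k C N]

/-! ### The linear structure of `Rex_C(M, N)` -/

instance (F G : RexFunctor k C M N) : Zero (F ⟶ G) :=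
  ⟨mkHom (fun _ => 0) (by simp) (fun c m => by simp [act_zero k])⟩
instance (F G : RexFunctor k C M N) : Add (F ⟶ G) :=
  ⟨fun f g => mkHom (fun m => app f m + app g m) (fun a => by simp)
    (fun c m => by simp [act_add k, app_comm])⟩
instance (F G : RexFunctor k C M N) : Neg (F ⟶ G) :=
  ⟨fun f => mkHom (fun m => -app f m) (fun a => by simp)
    (fun c m => by simp [act_neg k, app_comm])⟩
instance (F G : RexFunctor k C M N) : SMul k (F ⟶ G) :=
  ⟨fun r f => mkHom (fun m => r • app f m) (fun a => by simp)
    (fun c m => by simp [act_smul k, app_comm])⟩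

@[simp] lemma app_zero (F G : RexFunctor k C M N) (m : M) : app (0 : F ⟶ G) m = 0 := rfl
@[simp] lemma app_add {F G : RexFunctor k C M N} (f g : F ⟶ G) (m : M) :
    app (f + g) m = app f m + app g m := rfl
@[simp] lemma app_neg {F G : RexFunctor k C M N} (f : F ⟶ G) (m : M) :
    app (-f) m = -app f m := rfl
@[simp] lemma app_smul {F G : RexFunctor k C M N} (r : k) (f : F ⟶ G) (m : M) :
    app (r • f) m = r • app f m := rfl

instance (F G : RexFunctor k C M N) : AddCommGroup (F ⟶ G) where
  add_assoc f g h := by ext; simp [add_assoc]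
  zero_add f := by ext; simp
  add_zero f := by ext; simp
  add_comm f g := by ext; simp [add_comm]
  neg_add_cancel f := by ext; simp
  nsmul := nsmulRec
  zsmul := zsmulRec

instance (F G : RexFunctor k C M N) : Module k (F ⟶ G) where
  one_smul f := by ext; simp
  mul_smul a b f := by ext; simp [mul_smul]
  smul_zero a := by ext; simp
  smul_add a f g := by ext; simp
  add_smul a b f := by ext; simp [add_smul]
  zero_smul f := by ext; simp

instance : Preadditive (RexFunctor k C M N) where
  add_comp X Y Z f g h := by ext; simp
  comp_add X Y Z f g h := by ext; simp

instance : Linear k (RexFunctor k C M N) where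
  smul_comp X Y Z a f g := by ext; simp
  comp_smul X Y Z f a g := by ext; simp

/-! ### The action of the Drinfeld center on `Rex_C(M, N)` -/

section Raw

variable {x x' : C} (b : HalfBraiding x) (b' : HalfBraiding x')

lemma raw_left (F : RexFunctor k C M N) {c c' : C} (f : c ⟶ c') (m : M) :
    x ⊴ₗ F.map (f ⊵ₗ m) ≫ x ⊴ₗ δₗ F.toFunctor c' m ≫ (slide b c' (F.obj m)).hom =
      (x ⊴ₗ δₗ F.toFunctor c m ≫ (slide b c (F.obj m)).hom) ≫ f ⊵ₗ (x ⊙ₗ F.obj m) := by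
  rw [← MonoidalLeftAction.actionHomRight_comp_assoc, δₗ_naturality_left, Category.assoc,
    ← slide_naturality_left, MonoidalLeftAction.actionHomRight_comp_assoc]

lemma raw_right (F : RexFunctor k C M N) (c : C) {m m' : M} (f : m ⟶ m') :
    x ⊴ₗ F.map (c ⊴ₗ f) ≫ x ⊴ₗ δₗ F.toFunctor c m' ≫ (slide b c (F.obj m')).hom =
      (x ⊴ₗ δₗ F.toFunctor c m ≫ (slide b c (F.obj m)).hom) ≫ c ⊴ₗ x ⊴ₗ F.map f := by
  rw [← MonoidalLeftAction.actionHomRight_comp_assoc, δₗ_naturality_right, Category.assoc,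
    ← slide_naturality_right, MonoidalLeftAction.actionHomRight_comp_assoc]

lemma raw_assoc (F : RexFunctor k C M N) (c c' : C) (m : M) :
    (x ⊴ₗ δₗ F.toFunctor (c ⊗ c') m ≫ (slide b (c ⊗ c') (F.obj m)).hom) ≫
        (αₗ c c' (x ⊙ₗ F.obj m)).hom =
      x ⊴ₗ F.map (αₗ c c' m).hom ≫
        (x ⊴ₗ δₗ F.toFunctor c (c' ⊙ₗ m) ≫ (slide b c (F.obj (c' ⊙ₗ m))).hom) ≫
          c ⊴ₗ (x ⊴ₗ δₗ F.toFunctor c' m ≫ (slide b c' (F.obj m)).hom) := by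
  rw [MonoidalLeftAction.actionHomRight_comp, Category.assoc, Category.assoc, slide_assoc,
    ← reassoc_of% slide_naturality_right b c (δₗ F.toFunctor c' m),
    ← MonoidalLeftAction.actionHomRight_comp_assoc, ← MonoidalLeftAction.actionHomRight_comp_assoc,
    ← MonoidalLeftAction.actionHomRight_comp_assoc, δₗ_associativity]
  simp only [Category.assoc]

lemma raw_unit (F : RexFunctor k C M N) (m : M) :
    (x ⊴ₗ δₗ F.toFunctor (𝟙_ C) m ≫ (slide b (𝟙_ C) (F.obj m)).hom) ≫
        (λₗ (x ⊙ₗ F.obj m)).hom = x ⊴ₗ F.map (λₗ m).hom := by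
  rw [Category.assoc, slide_unit, ← MonoidalLeftAction.actionHomRight_comp, δₗ_unitality_hom]

end Raw

/-- The module functor `x . F`, sending `m` to `x . F m`, for a half-braiding on `x`. Its constraint
is `x . F (c . m) ≅ x . (c . F m) ≅ (x ⊗ c) . F m ≅ (c ⊗ x) . F m ≅ c . (x . F m)`, where the third
isomorphism is given by the half-braiding. -/
def actRaw {x : C} (b : HalfBraiding x) (F : RexFunctor k C M N) : RexFunctor k C M N where
  toFunctor := F.toFunctor ⋙ MonoidalLeftAction.actionLeft N x
  leftLinear := leftLinearOfIso _
    (fun c m => (MonoidalLeftAction.actionLeft N x).mapIso (F.φ c m) ≪≫ slide b c (F.obj m))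
    (fun f m => raw_left b F f m) (fun c _ _ f => raw_right b F c f)
    (fun c c' m => raw_assoc b F c c' m) (fun m => raw_unit b F m)
  additive :=
    haveI := FiniteModuleCategory.additive_actionLeft (k := k) (C := C) (M := N) x
    inferInstance
  linear :=
    haveI := FiniteModuleCategory.linear_actionLeft (k := k) (C := C) (M := N) x
    inferInstance
  rightExact :=
    haveI := FiniteModuleCategory.rightExact_actionLeft (k := k) (C := C) (M := N) x
    comp_preservesFiniteColimits _ _

lemma actRaw_δ {x : C} (b : HalfBraiding x) (F : RexFunctor k C M N) (c : C) (m : M) :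
    δₗ (actRaw b F).toFunctor c m = x ⊴ₗ δₗ F.toFunctor c m ≫ (slide b c (F.obj m)).hom := rfl

/-- Module natural isomorphisms from their components. -/
def mkIso {F G : RexFunctor k C M N} (f : ∀ m, F.obj m ≅ G.obj m)
    (hf : ∀ {m m' : M} (a : m ⟶ m'), F.map a ≫ (f m').hom = (f m).hom ≫ G.map a)
    (hf' : ∀ (c : C) (m : M),
      δₗ F.toFunctor c m ≫ c ⊴ₗ (f m).hom = (f (c ⊙ₗ m)).hom ≫ δₗ G.toFunctor c m) : F ≅ G where
  hom := mkHom (fun m => (f m).hom) hf hf'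
  inv := mkHom (fun m => (f m).inv)
    (fun {m m'} a => by rw [Iso.eq_inv_comp, ← Category.assoc, Iso.comp_inv_eq, hf])
    (fun c m => by
      rw [Iso.eq_inv_comp, ← reassoc_of% hf', MonoidalLeftAction.actionHomRight_hom_inv,
        Category.comp_id])
  hom_inv_id := by ext m; simp
  inv_hom_id := by ext m; simp

lemma act_comp_raw {x y z : C} {n n' n'' : N} (f : x ⟶ y) (f' : y ⟶ z) (g : n ⟶ n')
    (g' : n' ⟶ n'') : (f ≫ f') ⊵ₗ n ≫ z ⊴ₗ (g ≫ g') =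
      (f ⊵ₗ n ≫ y ⊴ₗ g) ≫ f' ⊵ₗ n' ≫ z ⊴ₗ g' := by
  simp [MonoidalLeftAction.action_exchange_assoc]

lemma raw_assoc_naturality {x₁ x₂ x₃ x₄ : C} {n n' : N} (f : x₁ ⟶ x₂) (g : x₃ ⟶ x₄) (h : n ⟶ n') :
    ((f ⊗ₘ g) ⊵ₗ n ≫ (x₂ ⊗ x₄) ⊴ₗ h) ≫ (αₗ x₂ x₄ n').hom =
      (αₗ x₁ x₃ n).hom ≫ f ⊵ₗ (x₃ ⊙ₗ n) ≫ x₂ ⊴ₗ (g ⊵ₗ n ≫ x₄ ⊴ₗ h) := by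
  have := MonoidalLeftAction.actionAssocIso_hom_naturality f g h
  simp only [MonoidalLeftAction.actionHom_def] at this
  exact this

section Raw

variable {x x' : C} {b : HalfBraiding x} {b' : HalfBraiding x'}

/-- The module natural transformation `x . F ⟶ x' . F` induced by a morphism `x ⟶ x'` compatible
with the half-braidings. -/
def actRawLeft (f : x ⟶ x') (hf : ∀ c, f ▷ c ≫ (b'.β c).hom = (b.β c).hom ≫ c ◁ f)
    (F : RexFunctor k C M N) : actRaw b F ⟶ actRaw b' F :=
  mkHom (F := actRaw b F) (G := actRaw b' F) (fun m => f ⊵ₗ F.obj m)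
    (fun {m m'} a => MonoidalLeftAction.action_exchange f (F.map a))
    (fun c m => by
      change (x ⊴ₗ δₗ F.toFunctor c m ≫ (slide b c (F.obj m)).hom) ≫ c ⊴ₗ f ⊵ₗ F.obj m =
        f ⊵ₗ F.obj (c ⊙ₗ m) ≫ x' ⊴ₗ δₗ F.toFunctor c m ≫ (slide b' c (F.obj m)).hom
      rw [Category.assoc, ← slide_map hf, MonoidalLeftAction.action_exchange_assoc])

/-- The module natural transformation `x . F ⟶ x . G` induced by `F ⟶ G`. -/
def actRawRight (b : HalfBraiding x) {F G : RexFunctor k C M N} (g : F ⟶ G) :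
    actRaw b F ⟶ actRaw b G :=
  mkHom (F := actRaw b F) (G := actRaw b G) (fun m => x ⊴ₗ app g m)
    (fun {m m'} a => by
      change x ⊴ₗ F.map a ≫ x ⊴ₗ app g m' = x ⊴ₗ app g m ≫ x ⊴ₗ G.map a
      rw [← MonoidalLeftAction.actionHomRight_comp, app_naturality,
        MonoidalLeftAction.actionHomRight_comp])
    (fun c m => by
      change (x ⊴ₗ δₗ F.toFunctor c m ≫ (slide b c (F.obj m)).hom) ≫ c ⊴ₗ x ⊴ₗ app g m =
        x ⊴ₗ app g (c ⊙ₗ m) ≫ x ⊴ₗ δₗ G.toFunctor c m ≫ (slide b c (G.obj m)).hom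
      rw [Category.assoc, ← slide_naturality_right,
        ← MonoidalLeftAction.actionHomRight_comp_assoc, app_comm,
        MonoidalLeftAction.actionHomRight_comp_assoc])

/-- The mixed associator `(x ⊗ x') . F ≅ x . (x' . F)`. -/
def actRawAssoc {b'' : HalfBraiding (x ⊗ x')}
    (hb : ∀ c, (b''.β c).hom = (α_ x x' c).hom ≫ x ◁ (b'.β c).hom ≫ (α_ x c x').inv ≫
      (b.β c).hom ▷ x' ≫ (α_ c x x').hom) (F : RexFunctor k C M N) :
    actRaw b'' F ≅ actRaw b (actRaw b' F) :=
  mkIso (F := actRaw b'' F) (G := actRaw b (actRaw b' F)) (fun m => αₗ x x' (F.obj m))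
    (fun {m m'} a => by
      change (x ⊗ x') ⊴ₗ F.map a ≫ (αₗ x x' (F.obj m')).hom =
        (αₗ x x' (F.obj m)).hom ≫ x ⊴ₗ x' ⊴ₗ F.map a
      simp)
    (fun c m => by
      change ((x ⊗ x') ⊴ₗ δₗ F.toFunctor c m ≫ (slide b'' c (F.obj m)).hom) ≫
          c ⊴ₗ (αₗ x x' (F.obj m)).hom =
        (αₗ x x' (F.obj (c ⊙ₗ m))).hom ≫
          x ⊴ₗ (x' ⊴ₗ δₗ F.toFunctor c m ≫ (slide b' c (F.obj m)).hom) ≫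
            (slide b c (x' ⊙ₗ F.obj m)).hom
      rw [Category.assoc, ← slide_tensor hb,
        MonoidalLeftAction.tensor_actionHomRight]
      simp only [Category.assoc, Iso.inv_hom_id_assoc, MonoidalLeftAction.actionHomRight_comp])

/-- The mixed unitor `𝟙 . F ≅ F`. -/
def actRawUnit {b : HalfBraiding (𝟙_ C)} (hb : ∀ c, (b.β c).hom = (λ_ c).hom ≫ (ρ_ c).inv)
    (F : RexFunctor k C M N) : actRaw b F ≅ F :=
  mkIso (F := actRaw b F) (G := F) (fun m => λₗ (F.obj m))
    (fun {m m'} a => (MonoidalLeftAction.actionUnitIso_hom_naturality (F.map a)).symm)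
    (fun c m => by
      change (𝟙_ C ⊴ₗ δₗ F.toFunctor c m ≫ (slide b c (F.obj m)).hom) ≫ c ⊴ₗ (λₗ (F.obj m)).hom =
        (λₗ (F.obj (c ⊙ₗ m))).hom ≫ δₗ F.toFunctor c m
      rw [Category.assoc, slide_tensorUnit hb]
      exact (MonoidalLeftAction.actionUnitIso_hom_naturality (δₗ F.toFunctor c m)).symm)

end Raw

/-- The module functor `z . F` for an object `z` of the Drinfeld center, with the constraint given
by the half-braiding of `z`. -/
def act (z : Center C) (F : RexFunctor k C M N) : RexFunctor k C M N := actRaw z.2 F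

/-- `Rex_C(M, N)` is a module category over the Drinfeld center of `C`. -/
instance : MonoidalLeftAction (Center C) (RexFunctor k C M N) where
  actionObj z F := act z F
  actionHomLeft {z z'} f F := actRawLeft f.f f.comm F
  actionHomRight z {F G} g := actRawRight z.2 g
  actionAssocIso z z' F := actRawAssoc (fun c => rfl) F
  actionUnitIso F := actRawUnit (fun c => rfl) F
  actionHom_def f g := rfl
  actionHomRight_id z F := by
    ext m
    exact MonoidalLeftAction.actionHomRight_id z.1 (F.obj m)
  id_actionHomLeft z F := by
    ext m
    exact MonoidalLeftAction.id_actionHomLeft z.1 (F.obj m)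
  actionHom_comp f₁ f₂ g₁ g₂ := by
    ext m
    exact act_comp_raw f₁.f f₂.f (app g₁ m) (app g₂ m)
  actionAssocIso_hom_naturality {c₁ c₂ c₃ c₄ d₁ d₂} f g h := by
    ext m
    exact raw_assoc_naturality f.f g.f (app h m)
  actionUnitIso_hom_naturality f := by
    ext m
    exact MonoidalLeftAction.actionUnitIso_hom_naturality (app f m)
  whiskerLeft_actionHomLeft c _ _ f d := by
    ext m
    exact MonoidalLeftAction.whiskerLeft_actionHomLeft c.1 f.f (d.obj m)
  whiskerRight_actionHomLeft c f d := by
    ext m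
    exact MonoidalLeftAction.whiskerRight_actionHomLeft c.1 f.f (d.obj m)
  associator_actionHom z₁ z₂ z₃ F := by
    ext m
    exact MonoidalLeftAction.associator_actionHom z₁.1 z₂.1 z₃.1 (F.obj m)
  leftUnitor_actionHom z F := by
    ext m
    exact MonoidalLeftAction.leftUnitor_actionHom z.1 (F.obj m)
  rightUnitor_actionHom z F := by
    ext m
    exact MonoidalLeftAction.rightUnitor_actionHom z.1 (F.obj m)

end RexFunctor

end Rex

/-! ### Projective generators of finite linear categories -/

section Generator

/-- The morphism `A ⟶ X` determined by an element of the module `X`. -/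
def ofElement {A : Type w} [Ring A] (X : FGModuleCat.{w} A) (s : X) : FGModuleCat.of A A ⟶ X :=
  FGModuleCat.ofHom (LinearMap.toSpanSingleton A X s)

lemma ofElement_comp {A : Type w} [Ring A] {X Y : FGModuleCat.{w} A} (s : X) (f : X ⟶ Y) :
    (ofElement X s ≫ f).hom.hom (1 : A) = f.hom.hom s :=
  congrArg f.hom.hom (one_smul A s)

lemma epi_of_jointlyEpi {D : Type u} [Category.{v} D] [Preadditive D] {ι : Type} {Q X : D}
    [HasBiproduct fun _ : ι => Q] (g : ι → (Q ⟶ X))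
    (hg : ∀ {Y : D} (u v : X ⟶ Y), (∀ i, g i ≫ u = g i ≫ v) → u = v) :
    Epi (biproduct.desc g) :=
  ⟨fun u v h => hg u v fun i => by
    rw [← biproduct.ι_desc g i, Category.assoc, Category.assoc, h]⟩

variable (k : Type w) [Field k] (D : Type u) [Category.{v} D] [Abelian D] [Linear k D]
  [FiniteLinearCategory k D]

lemma exists_generator : ∃ Q : D, Projective Q ∧
    (∀ X : D, ∃ (n : ℕ) (g : Fin n → (Q ⟶ X)),
      ∀ {Y : D} (u v : X ⟶ Y), (∀ i, g i ≫ u = g i ≫ v) → u = v) ∧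
    ∀ X : D, Module.Finite k (Q ⟶ X) := by
  obtain ⟨A, _, _, _, e, hadd, hlin⟩ := FiniteLinearCategory.exists_equivalence (k := k) (D := D)
  let Q₀ : FGModuleCat.{w} A := FGModuleCat.of A A
  have hgen : ∀ X : FGModuleCat.{w} A, ∃ (n : ℕ) (g : Fin n → (Q₀ ⟶ X)),
      ∀ {Y : FGModuleCat.{w} A} (u v : X ⟶ Y), (∀ i, g i ≫ u = g i ≫ v) → u = v := by
    intro X
    obtain ⟨n, s, hs⟩ := Module.Finite.exists_fin (R := A) (M := X)
    refine ⟨n, fun i => ofElement X (s i), ?_⟩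
    intro Y u v h
    ext1
    refine LinearMap.ext_on_range hs fun i => ?_
    have := congrArg (fun t => t.hom.hom (1 : A)) (h i)
    rwa [ofElement_comp, ofElement_comp] at this
  have hepi : ∀ {X Y : FGModuleCat.{w} A} (f : X ⟶ Y), Epi f → Function.Surjective f.hom.hom := by
    intro X Y f hf
    rw [← LinearMap.range_eq_top]
    have : Module.Finite A (Y ⧸ LinearMap.range f.hom.hom) := inferInstance
    let q : Y ⟶ FGModuleCat.of A (Y ⧸ LinearMap.range f.hom.hom) :=
      FGModuleCat.ofHom (LinearMap.range f.hom.hom).mkQ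
    have hq : f ≫ q = f ≫ 0 := by
      ext1
      ext x
      exact (Submodule.Quotient.mk_eq_zero _).2 (LinearMap.mem_range_self _ x)
    have h1 := (cancel_epi f).1 hq
    have h2 : (LinearMap.range f.hom.hom).mkQ = 0 := congrArg (fun t => t.hom.hom) h1
    rw [← Submodule.ker_mkQ (LinearMap.range f.hom.hom), h2, LinearMap.ker_zero]
  have hproj : Projective Q₀ := by
    constructor
    intro E X f p hp
    obtain ⟨y, hy⟩ := hepi p hp (f.hom.hom (1 : A))
    refine ⟨ofElement E y, ?_⟩
    ext1
    refine LinearMap.ext_ring ?_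
    exact (ofElement_comp y p).trans hy
  refine ⟨e.inverse.obj Q₀, ?_, ?_, ?_⟩
  · exact (e.symm.map_projective_iff Q₀).2 hproj
  · intro X
    obtain ⟨n, g, hg⟩ := hgen (e.functor.obj X)
    refine ⟨n, fun i => e.inverse.map (g i) ≫ e.unitInv.app X, ?_⟩
    intro Y u v h
    apply e.functor.map_injective
    refine hg _ _ fun i => ?_
    apply e.inverse.map_injective
    have := h i
    rw [Category.assoc, Category.assoc] at this
    have hu := e.unitInv.naturality u
    have hv := e.unitInv.naturality v
    simp only [Functor.comp_map, Functor.id_map] at hu hv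
    rw [← hu, ← hv, ← Category.assoc, ← Category.assoc, cancel_mono] at this
    rw [Functor.map_comp, Functor.map_comp]
    exact this
  · intro X
    let _ : Module k (e.functor.obj X) := Module.compHom _ (algebraMap k A)
    have : IsScalarTower k A (e.functor.obj X) :=
      IsScalarTower.of_algebraMap_smul fun a x => rfl
    have : Module.Finite k (e.functor.obj X) := Module.Finite.trans A _
    let E : (e.inverse.obj Q₀ ⟶ X) →ₗ[k] (e.functor.obj X) :=
      { toFun := fun f => (e.counitInv.app Q₀ ≫ e.functor.map f).hom.hom (1 : A)
        map_add' := fun f g => by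
          rw [Functor.map_add, Preadditive.comp_add]
          rfl
        map_smul' := fun r f => by
          rw [Functor.map_smul, Linear.comp_smul]
          rfl }
    refine Module.Finite.of_injective E fun f g h => ?_
    apply e.functor.map_injective
    rw [← cancel_epi (e.counitInv.app Q₀)]
    ext1
    exact LinearMap.ext_ring h

end Generator

section Existence

/-! ### Gluing half-braidings and module natural transformations -/

section Glue

variable {C : Type u} [Category.{v} C] [MonoidalCategory C]

/-- A half-braiding on `y` determined by a jointly epimorphic pair of morphisms to `y`. -/
def glueBraiding {x₁ x₂ y : C} (b₁ : HalfBraiding x₁) (b₂ : HalfBraiding x₂) (q₁ : x₁ ⟶ y)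
    (q₂ : x₂ ⟶ y) (s : ∀ U, y ⊗ U ≅ U ⊗ y)
    (h₁ : ∀ U, q₁ ▷ U ≫ (s U).hom = (b₁.β U).hom ≫ U ◁ q₁)
    (h₂ : ∀ U, q₂ ▷ U ≫ (s U).hom = (b₂.β U).hom ≫ U ◁ q₂)
    (je : ∀ (U : C) {Z : C} (u v : y ⊗ U ⟶ Z), q₁ ▷ U ≫ u = q₁ ▷ U ≫ v → q₂ ▷ U ≫ u = q₂ ▷ U ≫ v →
      u = v) : HalfBraiding y where
  β := s
  monoidal U U' := by
    have key : ∀ {x : C} (b : HalfBraiding x) (q : x ⟶ y)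
        (h : ∀ U, q ▷ U ≫ (s U).hom = (b.β U).hom ≫ U ◁ q),
        q ▷ (U ⊗ U') ≫ (s (U ⊗ U')).hom = q ▷ (U ⊗ U') ≫ (α_ y U U').inv ≫
          ((s U).hom ▷ U') ≫ (α_ U y U').hom ≫ (U ◁ (s U').hom) ≫ (α_ U U' y).inv := by
      intro x b q h
      rw [h, b.monoidal, whiskerRight_tensor]
      simp only [Category.assoc, Iso.hom_inv_id_assoc]
      rw [← comp_whiskerRight_assoc, h, comp_whiskerRight_assoc, whisker_assoc]
      simp only [Category.assoc, Iso.inv_hom_id_assoc]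
      rw [← MonoidalCategory.whiskerLeft_comp_assoc, h, MonoidalCategory.whiskerLeft_comp_assoc]
      simp
    exact je _ _ _ (key b₁ q₁ h₁) (key b₂ q₂ h₂)
  naturality {U U'} f := by
    have key : ∀ {x : C} (b : HalfBraiding x) (q : x ⟶ y)
        (h : ∀ U, q ▷ U ≫ (s U).hom = (b.β U).hom ≫ U ◁ q),
        q ▷ U ≫ (y ◁ f ≫ (s U').hom) = q ▷ U ≫ ((s U).hom ≫ f ▷ y) := by
      intro x b q h
      rw [← whisker_exchange_assoc, h, reassoc_of% h, b.naturality_assoc, whisker_exchange]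
    exact je _ _ _ (key b₁ q₁ h₁) (key b₂ q₂ h₂)

end Glue

variable {k : Type w} [Field k] {C : Type u} [Category.{v} C] [Abelian C] [Linear k C]
  [MonoidalCategory C]
  {M : Type u₁} [Category.{v₁} M] [Abelian M] [Linear k M] [MonoidalLeftAction C M]
  {N : Type u₂} [Category.{v₂} N] [Abelian N] [Linear k N] [MonoidalLeftAction C N]

/-- An object `x` with a half-braiding, together with a module natural transformation from `x . F`
to `G`. -/
structure CenterPair (F G : RexFunctor k C M N) where
  x : C
  b : HalfBraiding x
  η (m : M) : x ⊙ₗ F.obj m ⟶ G.obj m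
  nat {m m' : M} (a : m ⟶ m') : x ⊴ₗ F.map a ≫ η m' = η m ≫ G.map a
  comm (c : C) (m : M) :
    (x ⊴ₗ δₗ F.toFunctor c m ≫ (slide b c (F.obj m)).hom) ≫ c ⊴ₗ η m =
      η (c ⊙ₗ m) ≫ δₗ G.toFunctor c m

namespace CenterPair

variable {F G : RexFunctor k C M N}

/-- Morphisms of pairs. -/
structure IsHom (S T : CenterPair F G) (f : S.x ⟶ T.x) : Prop where
  comm (c : C) : f ▷ c ≫ (T.b.β c).hom = (S.b.β c).hom ≫ c ◁ f
  comp (m : M) : f ⊵ₗ F.obj m ≫ T.η m = S.η m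

lemma IsHom.trans {S T U : CenterPair F G} {f : S.x ⟶ T.x} {g : T.x ⟶ U.x} (hf : IsHom S T f)
    (hg : IsHom T U g) : IsHom S U (f ≫ g) where
  comm c := by
    rw [comp_whiskerRight, Category.assoc, hg.comm, reassoc_of% hf.comm,
      MonoidalCategory.whiskerLeft_comp]
  comp m := by
    rw [MonoidalLeftAction.comp_actionHomLeft, Category.assoc, hg.comp, hf.comp]

lemma IsHom.symm {S T : CenterPair F G} {f : S.x ⟶ T.x} (hf : IsHom S T f) [IsIso f] :
    IsHom T S (inv f) where
  comm c := by
    rw [← cancel_epi (f ▷ c), ← comp_whiskerRight_assoc, IsIso.hom_inv_id, id_whiskerRight,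
      Category.id_comp, reassoc_of% hf.comm, ← MonoidalCategory.whiskerLeft_comp, IsIso.hom_inv_id]
    simp
  comp m := by
    rw [← hf.comp, ← MonoidalLeftAction.comp_actionHomLeft_assoc, IsIso.inv_hom_id]
    simp

/-- Gluing pairs along a jointly epimorphic pair of morphisms. -/
def glue (S₁ S₂ : CenterPair F G) {y : C} (q₁ : S₁.x ⟶ y)
    (q₂ : S₂.x ⟶ y) (s : ∀ U, y ⊗ U ≅ U ⊗ y)
    (h₁ : ∀ U, q₁ ▷ U ≫ (s U).hom = (S₁.b.β U).hom ≫ U ◁ q₁)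
    (h₂ : ∀ U, q₂ ▷ U ≫ (s U).hom = (S₂.b.β U).hom ≫ U ◁ q₂)
    (je : ∀ (U : C) {Z : C} (u v : y ⊗ U ⟶ Z), q₁ ▷ U ≫ u = q₁ ▷ U ≫ v → q₂ ▷ U ≫ u = q₂ ▷ U ≫ v →
      u = v)
    (je' : ∀ (n : N) {Z : N} (u v : y ⊙ₗ n ⟶ Z), q₁ ⊵ₗ n ≫ u = q₁ ⊵ₗ n ≫ v →
      q₂ ⊵ₗ n ≫ u = q₂ ⊵ₗ n ≫ v → u = v)
    (θ : ∀ m, y ⊙ₗ F.obj m ⟶ G.obj m) (e₁ : ∀ m, q₁ ⊵ₗ F.obj m ≫ θ m = S₁.η m)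
    (e₂ : ∀ m, q₂ ⊵ₗ F.obj m ≫ θ m = S₂.η m) : CenterPair F G where
  x := y
  b := glueBraiding S₁.b S₂.b q₁ q₂ s h₁ h₂ je
  η := θ
  nat {m m'} a := by
    have key : ∀ (S : CenterPair F G) (q : S.x ⟶ y) (e : ∀ m, q ⊵ₗ F.obj m ≫ θ m = S.η m),
        q ⊵ₗ F.obj m ≫ y ⊴ₗ F.map a ≫ θ m' = q ⊵ₗ F.obj m ≫ θ m ≫ G.map a := by
      intro S q e
      rw [← MonoidalLeftAction.action_exchange_assoc, e, reassoc_of% e, S.nat]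
    exact je' _ _ _ (key _ q₁ e₁) (key _ q₂ e₂)
  comm c m := by
    have key : ∀ (S : CenterPair F G) (q : S.x ⟶ y) (e : ∀ m, q ⊵ₗ F.obj m ≫ θ m = S.η m)
        (h : ∀ U, q ▷ U ≫ (s U).hom = (S.b.β U).hom ≫ U ◁ q),
        q ⊵ₗ F.obj (c ⊙ₗ m) ≫ (y ⊴ₗ δₗ F.toFunctor c m ≫
          (slide (glueBraiding S₁.b S₂.b q₁ q₂ s h₁ h₂ je) c (F.obj m)).hom) ≫ c ⊴ₗ θ m =
        q ⊵ₗ F.obj (c ⊙ₗ m) ≫ θ (c ⊙ₗ m) ≫ δₗ G.toFunctor c m := by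
      intro S q e h
      rw [reassoc_of% e, ← S.comm, Category.assoc, Category.assoc,
        ← MonoidalLeftAction.action_exchange_assoc,
        reassoc_of% slide_map (b := S.b) (b' := glueBraiding S₁.b S₂.b q₁ q₂ s h₁ h₂ je) (f := q) h,
        ← MonoidalLeftAction.actionHomRight_comp, e]
    exact je' _ _ _ (key _ q₁ e₁ h₁) (key _ q₂ e₂ h₂)

end CenterPair

namespace CenterPair

variable {F G : RexFunctor k C M N}

section Sum

variable [MonoidalPreadditive C] [FiniteModuleCategory k C N]

attribute [local instance] Abelian.hasFiniteBiproducts in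
lemma exists_sum (S T : CenterPair F G) : ∃ (U : CenterPair F G) (i : S.x ⟶ U.x) (j : T.x ⟶ U.x),
    IsHom S U i ∧ IsHom T U j := by
  let y : C := S.x ⊞ T.x
  let q₁ : S.x ⟶ y := biprod.inl
  let q₂ : T.x ⟶ y := biprod.inr
  let p₁ : y ⟶ S.x := biprod.fst
  let p₂ : y ⟶ T.x := biprod.snd
  have h11 : q₁ ≫ p₁ = 𝟙 _ := biprod.inl_fst
  have h12 : q₁ ≫ p₂ = 0 := biprod.inl_snd
  have h21 : q₂ ≫ p₁ = 0 := biprod.inr_fst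
  have h22 : q₂ ≫ p₂ = 𝟙 _ := biprod.inr_snd
  have ht : p₁ ≫ q₁ + p₂ ≫ q₂ = 𝟙 _ := biprod.total
  clear_value q₁ q₂ p₁ p₂
  have je : ∀ (U : C) {Z : C} (u v : y ⊗ U ⟶ Z), q₁ ▷ U ≫ u = q₁ ▷ U ≫ v →
      q₂ ▷ U ≫ u = q₂ ▷ U ≫ v → u = v := by
    intro U Z u v h₁ h₂
    rw [← Category.id_comp u, ← Category.id_comp v, ← id_whiskerRight, ← ht,
      MonoidalPreadditive.add_whiskerRight]
    simp [h₁, h₂]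
  have je' : ∀ (n : N) {Z : N} (u v : y ⊙ₗ n ⟶ Z), q₁ ⊵ₗ n ≫ u = q₁ ⊵ₗ n ≫ v →
      q₂ ⊵ₗ n ≫ u = q₂ ⊵ₗ n ≫ v → u = v := by
    intro U Z u v h₁ h₂
    rw [← Category.id_comp u, ← Category.id_comp v, ← MonoidalLeftAction.id_actionHomLeft, ← ht,
      add_act k]
    simp [h₁, h₂]
  have z₁₂ : ∀ U, q₁ ▷ U ≫ p₂ ▷ U = 0 := fun U => by rw [← comp_whiskerRight, h12]; simp
  have z₂₁ : ∀ U, q₂ ▷ U ≫ p₁ ▷ U = 0 := fun U => by rw [← comp_whiskerRight, h21]; simp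
  have z₁₁ : ∀ U, q₁ ▷ U ≫ p₁ ▷ U = 𝟙 _ := fun U => by rw [← comp_whiskerRight, h11]; simp
  have z₂₂ : ∀ U, q₂ ▷ U ≫ p₂ ▷ U = 𝟙 _ := fun U => by rw [← comp_whiskerRight, h22]; simp
  have y₁₂ : ∀ U, U ◁ q₁ ≫ U ◁ p₂ = 0 := fun U => by
    rw [← MonoidalCategory.whiskerLeft_comp, h12]; simp
  have y₂₁ : ∀ U, U ◁ q₂ ≫ U ◁ p₁ = 0 := fun U => by
    rw [← MonoidalCategory.whiskerLeft_comp, h21]; simp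
  have y₁₁ : ∀ U, U ◁ q₁ ≫ U ◁ p₁ = 𝟙 _ := fun U => by
    rw [← MonoidalCategory.whiskerLeft_comp, h11]; simp
  have y₂₂ : ∀ U, U ◁ q₂ ≫ U ◁ p₂ = 𝟙 _ := fun U => by
    rw [← MonoidalCategory.whiskerLeft_comp, h22]; simp
  have t₁ : ∀ U, p₁ ▷ U ≫ q₁ ▷ U + p₂ ▷ U ≫ q₂ ▷ U = 𝟙 _ := fun U => by
    rw [← comp_whiskerRight, ← comp_whiskerRight, ← MonoidalPreadditive.add_whiskerRight, ht,
      id_whiskerRight]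
  have t₂ : ∀ U, U ◁ p₁ ≫ U ◁ q₁ + U ◁ p₂ ≫ U ◁ q₂ = 𝟙 _ := fun U => by
    rw [← MonoidalCategory.whiskerLeft_comp, ← MonoidalCategory.whiskerLeft_comp,
      ← MonoidalPreadditive.whiskerLeft_add, ht, MonoidalCategory.whiskerLeft_id]
  let s : ∀ U, y ⊗ U ≅ U ⊗ y := fun U =>
    { hom := p₁ ▷ U ≫ (S.b.β U).hom ≫ U ◁ q₁ + p₂ ▷ U ≫ (T.b.β U).hom ≫ U ◁ q₂
      inv := U ◁ p₁ ≫ (S.b.β U).inv ≫ q₁ ▷ U + U ◁ p₂ ≫ (T.b.β U).inv ≫ q₂ ▷ U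
      hom_inv_id := by
        simp [reassoc_of% y₁₁, reassoc_of% y₁₂, reassoc_of% y₂₁, reassoc_of% y₂₂, t₁]
      inv_hom_id := by
        simp [reassoc_of% z₁₁, reassoc_of% z₁₂, reassoc_of% z₂₁, reassoc_of% z₂₂, t₂] }
  have s₁ : ∀ U, q₁ ▷ U ≫ (s U).hom = (S.b.β U).hom ≫ U ◁ q₁ := fun U => by
    simp [s, reassoc_of% z₁₁, reassoc_of% z₁₂]
  have s₂ : ∀ U, q₂ ▷ U ≫ (s U).hom = (T.b.β U).hom ≫ U ◁ q₂ := fun U => by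
    simp [s, reassoc_of% z₂₁, reassoc_of% z₂₂]
  let θ : ∀ m, y ⊙ₗ F.obj m ⟶ G.obj m := fun m =>
    p₁ ⊵ₗ F.obj m ≫ S.η m + p₂ ⊵ₗ F.obj m ≫ T.η m
  have e₁ : ∀ m, q₁ ⊵ₗ F.obj m ≫ θ m = S.η m := fun m => by
    simp only [θ, Preadditive.comp_add, ← MonoidalLeftAction.comp_actionHomLeft_assoc, h11, h12]
    simp [zero_act k]
  have e₂ : ∀ m, q₂ ⊵ₗ F.obj m ≫ θ m = T.η m := fun m => by
    simp only [θ, Preadditive.comp_add, ← MonoidalLeftAction.comp_actionHomLeft_assoc, h21, h22]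
    simp [zero_act k]
  exact ⟨glue S T q₁ q₂ s s₁ s₂ je je' θ e₁ e₂, q₁, q₂, ⟨s₁, e₁⟩, ⟨s₂, e₂⟩⟩

end Sum

section Quotient

lemma exists_desc {D : Type u₁} [Category.{v₁} D] [Abelian D] {E : Type u₂} [Category.{v₂} E]
    [Abelian E] (Φ : D ⥤ E) [Φ.Additive] [PreservesFiniteColimits Φ] {X Y : D} (t : X ⟶ Y) {Z : E}
    (g : Φ.obj Y ⟶ Z) (h : Φ.map t ≫ g = 0) :
    ∃ d : Φ.obj (cokernel t) ⟶ Z, Φ.map (cokernel.π t) ≫ d = g := by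
  refine ⟨(PreservesCokernel.iso Φ t).hom ≫ cokernel.desc _ g h, ?_⟩
  rw [← Category.assoc, PreservesCokernel.π_iso_hom, cokernel.π_desc]

variable [RigidCategory C] [MonoidalPreadditive C] [FiniteModuleCategory k C N]

instance tensorRight_rightExact (U : C) : PreservesFiniteColimits (tensorRight U) :=
  have := (tensorRightAdjunction U Uᘁ).leftAdjoint_preservesColimits
  inferInstance

instance tensorLeft_rightExact (U : C) : PreservesFiniteColimits (tensorLeft U) :=
  have := (tensorLeftAdjunction (ᘁU) U).leftAdjoint_preservesColimits
  inferInstance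

/-- A morphism to `S.x` is negligible if it is annihilated by the natural transformation. -/
def Negligible (S : CenterPair F G) {a : C} (g : a ⟶ S.x) : Prop :=
  ∀ m, g ⊵ₗ F.obj m ≫ S.η m = 0

lemma mate_left {x a U V : C} [ExactPairing U V] (f : a ⟶ U ⊗ x) {n n' : N} (e : x ⊙ₗ n ⟶ n') :
    (tensorLeftHomEquiv a U V x).symm f ⊵ₗ n ≫ e =
      (αₗ V a n).hom ≫ V ⊴ₗ (f ⊵ₗ n ≫ (αₗ U x n).hom ≫ U ⊴ₗ e) ≫ (αₗ V U n').inv ≫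
        (ε_ U V) ⊵ₗ n' ≫ (λₗ n').hom := by
  have h : (αₗ V (U ⊗ x) n).inv ≫ (α_ V U x).inv ⊵ₗ n ≫ (αₗ (V ⊗ U) x n).hom =
      V ⊴ₗ (αₗ U x n).hom ≫ (αₗ V U (x ⊙ₗ n)).inv := by
    rw [Iso.inv_comp_eq]
    have := act_pentagon' V U x n (αₗ V U (x ⊙ₗ n)).inv
    simpa using this
  have h1 : (tensorLeftHomEquiv a U V x).symm f =
      V ◁ f ≫ (α_ _ _ _).inv ≫ (ε_ U V) ▷ x ≫ (λ_ _).hom := rfl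
  have h2 : (αₗ V U (x ⊙ₗ n)).inv ≫ (V ⊗ U) ⊴ₗ e = V ⊴ₗ U ⊴ₗ e ≫ (αₗ V U n').inv := by
    simp
  have h3 : (𝟙_ C) ⊴ₗ e ≫ (λₗ n').hom = (λₗ (x ⊙ₗ n)).hom ≫ e :=
    (MonoidalLeftAction.actionUnitIso_hom_naturality e).symm
  rw [h1]
  simp only [MonoidalLeftAction.comp_actionHomLeft, MonoidalLeftAction.whiskerLeft_actionHomLeft,
    MonoidalLeftAction.whiskerRight_actionHomLeft, MonoidalLeftAction.leftUnitor_actionHom,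
    MonoidalLeftAction.actionHomRight_comp, Category.assoc, Iso.inv_hom_id_assoc]
  rw [reassoc_of% h, ← h3, ← MonoidalLeftAction.action_exchange_assoc, reassoc_of% h2]

lemma mate_right {x a U V : C} [ExactPairing V U] (f : a ⟶ x ⊗ U) (n : N) :
    (tensorRightHomEquiv a V U x).symm f ⊵ₗ n =
      (αₗ a V n).hom ≫ f ⊵ₗ (V ⊙ₗ n) ≫ (αₗ x U (V ⊙ₗ n)).hom ≫
        x ⊴ₗ ((αₗ U V n).inv ≫ (ε_ V U) ⊵ₗ n ≫ (λₗ n).hom) := by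
  have h1 : (tensorRightHomEquiv a V U x).symm f =
      f ▷ V ≫ (α_ _ _ _).hom ≫ x ◁ (ε_ V U) ≫ (ρ_ _).hom := rfl
  have h : (αₗ (x ⊗ U) V n).inv ≫ (α_ x U V).hom ⊵ₗ n ≫ (αₗ x (U ⊗ V) n).hom =
      (αₗ x U (V ⊙ₗ n)).hom ≫ x ⊴ₗ (αₗ U V n).inv := by
    rw [Iso.inv_comp_eq, act_pentagon]
    simp
  rw [h1]
  simp only [MonoidalLeftAction.comp_actionHomLeft, MonoidalLeftAction.whiskerLeft_actionHomLeft,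
    MonoidalLeftAction.whiskerRight_actionHomLeft, MonoidalLeftAction.rightUnitor_actionHom,
    MonoidalLeftAction.actionHomRight_comp, Category.assoc, Iso.inv_hom_id_assoc]
  rw [reassoc_of% h]

lemma dual_eval (F : RexFunctor k C M N) (U V : C) [ExactPairing V U] (m : M) :
    U ⊴ₗ μₗ F.toFunctor V m ≫ μₗ F.toFunctor U (V ⊙ₗ m) ≫
        F.map ((αₗ U V m).inv ≫ (ε_ V U) ⊵ₗ m ≫ (λₗ m).hom) =
      (αₗ U V (F.obj m)).inv ≫ (ε_ V U) ⊵ₗ F.obj m ≫ (λₗ (F.obj m)).hom := by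
  rw [Iso.eq_inv_comp, μₗ_unitality (C := C) F.toFunctor m,
    reassoc_of% μₗ_naturality_left F.toFunctor, ← F.toFunctor.map_comp,
    ← μₗ_associativity_assoc, ← F.toFunctor.map_comp, Iso.hom_inv_id_assoc]

lemma negligible_left (S : CenterPair F G) {a U V : C} [ExactPairing U V] (f : a ⟶ U ⊗ S.x)
    (hf : ∀ m, f ⊵ₗ F.obj m ≫ (αₗ U S.x (F.obj m)).hom ≫ U ⊴ₗ S.η m = 0) :
    S.Negligible ((tensorLeftHomEquiv a U V S.x).symm f) := by
  intro m
  rw [mate_left, hf, act_zero k, zero_comp, comp_zero]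

lemma negligible_right (S : CenterPair F G) {a U V : C} [ExactPairing V U] (f : a ⟶ S.x ⊗ U)
    (hf : ∀ m, f ⊵ₗ F.obj m ≫ (αₗ S.x U (F.obj m)).hom ≫ S.x ⊴ₗ μₗ F.toFunctor U m ≫
      S.η (U ⊙ₗ m) = 0) :
    S.Negligible ((tensorRightHomEquiv a V U S.x).symm f) := by
  intro m
  rw [mate_right, ← dual_eval]
  simp only [MonoidalLeftAction.actionHomRight_comp, Category.assoc, S.nat]
  have h : f ⊵ₗ (V ⊙ₗ F.obj m) ≫ (αₗ S.x U (V ⊙ₗ F.obj m)).hom ≫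
      S.x ⊴ₗ U ⊴ₗ μₗ F.toFunctor V m = a ⊴ₗ μₗ F.toFunctor V m ≫
        f ⊵ₗ (F.obj (V ⊙ₗ m)) ≫ (αₗ S.x U (F.obj (V ⊙ₗ m))).hom := by
    have h1 : (S.x ⊗ U) ⊴ₗ μₗ F.toFunctor V m ≫ (αₗ S.x U (F.obj (V ⊙ₗ m))).hom =
        (αₗ S.x U (V ⊙ₗ F.obj m)).hom ≫ S.x ⊴ₗ U ⊴ₗ μₗ F.toFunctor V m := by simp
    rw [← h1, MonoidalLeftAction.action_exchange_assoc]
  have h0 := hf (V ⊙ₗ m)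
  rw [reassoc_of% h, reassoc_of% h0]
  simp

lemma comm_left (S : CenterPair F G) (U : C) (m : M) :
    (S.b.β U).hom ⊵ₗ F.obj m ≫ (αₗ U S.x (F.obj m)).hom ≫ U ⊴ₗ S.η m =
      (αₗ S.x U (F.obj m)).hom ≫ S.x ⊴ₗ μₗ F.toFunctor U m ≫ S.η (U ⊙ₗ m) ≫
        δₗ G.toFunctor U m := by
  rw [← S.comm, Category.assoc, ← MonoidalLeftAction.actionHomRight_comp_assoc,
    Functor.LeftLinear.μₗ_comp_δₗ]
  simp

lemma comm_right (S : CenterPair F G) (U : C) (m : M) :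
    (S.b.β U).inv ⊵ₗ F.obj m ≫ (αₗ S.x U (F.obj m)).hom ≫ S.x ⊴ₗ μₗ F.toFunctor U m ≫
        S.η (U ⊙ₗ m) = (αₗ U S.x (F.obj m)).hom ≫ U ⊴ₗ S.η m ≫ μₗ G.toFunctor U m := by
  have h := S.comm_left U m =≫ μₗ G.toFunctor U m
  simp only [Category.assoc, Functor.LeftLinear.δₗ_comp_μₗ, Category.comp_id] at h
  rw [← h]
  simp

lemma exists_quotient (S : CenterPair F G) {a : C} (t : a ⟶ S.x) (ht : S.Negligible t)
    (hS : ∀ {a' : C} (g : a' ⟶ S.x), S.Negligible g → g ≫ cokernel.π t = 0) :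
    ∃ (T : CenterPair F G) (q : S.x ⟶ T.x), IsHom S T q ∧ Epi q ∧
      ∀ {a' : C} (g : a' ⟶ S.x), S.Negligible g → g ≫ q = 0 := by
  have eR : ∀ U, Epi (cokernel.π t ▷ U) := fun U =>
    inferInstanceAs (Epi ((tensorRight U).map (cokernel.π t)))
  have eL : ∀ U, Epi (U ◁ cokernel.π t) := fun U =>
    inferInstanceAs (Epi ((tensorLeft U).map (cokernel.π t)))
  have aR : ∀ n : N, Functor.Additive (MonoidalLeftAction.actionRight C n) := fun n =>
    FiniteModuleCategory.additive_actionRight (k := k) n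
  have rR : ∀ n : N, PreservesFiniteColimits (MonoidalLeftAction.actionRight C n) := fun n =>
    FiniteModuleCategory.rightExact_actionRight (k := k) n
  have eA : ∀ n : N, Epi (cokernel.π t ⊵ₗ n) := fun n =>
    inferInstanceAs (Epi ((MonoidalLeftAction.actionRight C n).map (cokernel.π t)))
  -- the half-braiding descends
  have hβ : ∀ U, t ▷ U ≫ (S.b.β U).hom ≫ U ◁ cokernel.π t = 0 := by
    intro U
    have hf : ∀ m, (t ▷ U ≫ (S.b.β U).hom) ⊵ₗ F.obj m ≫ (αₗ U S.x (F.obj m)).hom ≫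
        U ⊴ₗ S.η m = 0 := by
      intro m
      have h1 : (t ▷ U) ⊵ₗ F.obj m ≫ (αₗ S.x U (F.obj m)).hom =
          (αₗ a U (F.obj m)).hom ≫ t ⊵ₗ (U ⊙ₗ F.obj m) := by simp
      rw [MonoidalLeftAction.comp_actionHomLeft, Category.assoc, comm_left, reassoc_of% h1,
        ← MonoidalLeftAction.action_exchange_assoc, reassoc_of% ht (U ⊙ₗ m)]
      simp
    have h := hS _ (S.negligible_left (V := Uᘁ) _ hf)
    have h2 := tensorLeftHomEquiv_naturality (Y := U) (Y' := Uᘁ)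
      ((tensorLeftHomEquiv (a ⊗ U) U Uᘁ S.x).symm (t ▷ U ≫ (S.b.β U).hom)) (cokernel.π t)
    rw [h, Equiv.apply_symm_apply, Category.assoc] at h2
    rw [← h2]
    simp [tensorLeftHomEquiv]
  have hβ' : ∀ U, U ◁ t ≫ (S.b.β U).inv ≫ cokernel.π t ▷ U = 0 := by
    intro U
    have hf : ∀ m, (U ◁ t ≫ (S.b.β U).inv) ⊵ₗ F.obj m ≫ (αₗ S.x U (F.obj m)).hom ≫
        S.x ⊴ₗ μₗ F.toFunctor U m ≫ S.η (U ⊙ₗ m) = 0 := by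
      intro m
      have h1 : (U ◁ t) ⊵ₗ F.obj m ≫ (αₗ U S.x (F.obj m)).hom =
          (αₗ U a (F.obj m)).hom ≫ U ⊴ₗ t ⊵ₗ F.obj m := by simp
      rw [MonoidalLeftAction.comp_actionHomLeft, Category.assoc, comm_right, reassoc_of% h1,
        ← MonoidalLeftAction.actionHomRight_comp_assoc, ht, act_zero k]
      simp
    have h := hS _ (S.negligible_right (V := ᘁU) _ hf)
    have h2 := tensorRightHomEquiv_naturality (Y := ᘁU) (Y' := U)
      ((tensorRightHomEquiv (U ⊗ a) (ᘁU) U S.x).symm (U ◁ t ≫ (S.b.β U).inv)) (cokernel.π t)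
    rw [h, Equiv.apply_symm_apply, Category.assoc] at h2
    rw [← h2]
    simp [tensorRightHomEquiv]
  have h₁ := fun U => exists_desc (tensorRight U) t _ (hβ U)
  have h₂ := fun U => exists_desc (tensorLeft U) t _ (hβ' U)
  have h₃ := fun m => exists_desc (MonoidalLeftAction.actionRight C (F.obj m)) t _ (ht m)
  choose d₁ e₁ using h₁
  choose d₂ e₂ using h₂
  choose θ e₃ using h₃
  have e₁ : ∀ U, cokernel.π t ▷ U ≫ d₁ U = (S.b.β U).hom ≫ U ◁ cokernel.π t := e₁
  have e₂ : ∀ U, U ◁ cokernel.π t ≫ d₂ U = (S.b.β U).inv ≫ cokernel.π t ▷ U := e₂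
  let s : ∀ U, cokernel t ⊗ U ≅ U ⊗ cokernel t := fun U =>
    { hom := d₁ U
      inv := d₂ U
      hom_inv_id := by
        rw [← cancel_epi (cokernel.π t ▷ U), reassoc_of% e₁, e₂]
        simp
      inv_hom_id := by
        rw [← cancel_epi (U ◁ cokernel.π t), reassoc_of% e₂, e₁]
        simp }
  exact ⟨glue S S (cokernel.π t) (cokernel.π t) s e₁ e₁ (fun U _ u v h _ => (cancel_epi _).1 h)
    (fun n _ u v h _ => (cancel_epi _).1 h) θ e₃ e₃, cokernel.π t, ⟨e₁, e₃⟩,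
    inferInstanceAs (Epi (cokernel.π t)), hS⟩

end Quotient

end CenterPair

/-! ### Existence of a universal pair -/

lemma finite_hom (k : Type w) [Field k] (D : Type u) [Category.{v} D] [Abelian D] [Linear k D]
    [FiniteLinearCategory k D] (X Y : D) : Module.Finite k (X ⟶ Y) := by
  obtain ⟨Q, -, hQ, hf⟩ := exists_generator k D
  obtain ⟨n, g, hg⟩ := hQ X
  have := hf Y
  exact Module.Finite.of_injective
    (LinearMap.pi fun i => Linear.leftComp k Y (g i) : (X ⟶ Y) →ₗ[k] (Fin n → (Q ⟶ Y)))
    fun u v h => hg u v fun i => congrFun h i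

attribute [local instance] Abelian.hasFiniteBiproducts in
lemma natTrans_zero_of_generator {D : Type u₁} [Category.{v₁} D] [Abelian D] {E : Type u₂}
    [Category.{v₂} E] [Abelian E] {Φ Ψ : D ⥤ E} [Φ.Additive] [PreservesFiniteColimits Φ]
    (ζ : Φ ⟶ Ψ) {P : D} (hP : ∀ m : D, ∃ (n : ℕ) (g : Fin n → (P ⟶ m)),
      ∀ {Y : D} (u v : m ⟶ Y), (∀ i, g i ≫ u = g i ≫ v) → u = v) (h : ζ.app P = 0) (m : D) :
    ζ.app m = 0 := by
  obtain ⟨n, p, hp⟩ := hP m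
  have he : Epi (biproduct.desc p) := epi_of_jointlyEpi p hp
  rw [← cancel_epi (Φ.map (biproduct.desc p)), ζ.naturality, comp_zero]
  suffices h : ζ.app (⨁ fun _ : Fin n => P) = 0 by rw [h, zero_comp]
  have hid : 𝟙 (Φ.obj (⨁ fun _ : Fin n => P)) = ∑ i : Fin n,
      Φ.map (biproduct.π (fun _ : Fin n => P) i) ≫ Φ.map (biproduct.ι (fun _ : Fin n => P) i) := by
    rw [← Φ.map_id, ← biproduct.total, Φ.map_sum]
    simp only [Functor.map_comp]
  rw [← Category.id_comp (ζ.app _), hid, Preadditive.sum_comp]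
  refine Finset.sum_eq_zero fun i _ => ?_
  rw [Category.assoc, ζ.naturality, h, zero_comp, comp_zero]

attribute [local instance] Abelian.hasFiniteBiproducts in
lemma map_desc_comp_eq_zero {D : Type u₁} [Category.{v₁} D] [Abelian D] {E : Type u₂}
    [Category.{v₂} E] [Abelian E] (Φ : D ⥤ E) [Φ.Additive] {n : ℕ} {Q X : D}
    (g : Fin n → (Q ⟶ X)) {Z : E} (e : Φ.obj X ⟶ Z) (h : ∀ i, Φ.map (g i) ≫ e = 0) :
    Φ.map (biproduct.desc g) ≫ e = 0 := by
  rw [biproduct.desc_eq, Φ.map_sum, Preadditive.sum_comp]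
  refine Finset.sum_eq_zero fun i _ => ?_
  rw [Φ.map_comp, Category.assoc, h, comp_zero]

namespace CenterPair

variable {F G : RexFunctor k C M N}

section Terminal

variable [RigidCategory C] [FiniteTensorCategory k C] [FiniteModuleCategory k C M]
  [FiniteModuleCategory k C N]

/-- It suffices to test negligibility on a generator. -/
lemma negligible_of_generator (S : CenterPair F G) {P : M}
    (hP : ∀ m : M, ∃ (n : ℕ) (g : Fin n → (P ⟶ m)),
      ∀ {Y : M} (u v : m ⟶ Y), (∀ i, g i ≫ u = g i ≫ v) → u = v)
    {a : C} (g : a ⟶ S.x) (hg : g ⊵ₗ F.obj P ≫ S.η P = 0) : S.Negligible g := by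
  intro m
  have aL : Functor.Additive (MonoidalLeftAction.actionLeft N a) :=
    FiniteModuleCategory.additive_actionLeft (k := k) a
  have rL : PreservesFiniteColimits (MonoidalLeftAction.actionLeft N a) :=
    FiniteModuleCategory.rightExact_actionLeft (k := k) a
  let Φ : M ⥤ N := F.toFunctor ⋙ MonoidalLeftAction.actionLeft N a
  have hΦ : PreservesFiniteColimits Φ := comp_preservesFiniteColimits _ _
  have hnat : ∀ {m m' : M} (f : m ⟶ m'), a ⊴ₗ F.map f ≫ g ⊵ₗ F.obj m' ≫ S.η m' =
      (g ⊵ₗ F.obj m ≫ S.η m) ≫ G.map f := by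
    intro m m' f
    rw [Category.assoc, ← S.nat, MonoidalLeftAction.action_exchange_assoc]
  exact natTrans_zero_of_generator (Φ := Φ) (Ψ := G.toFunctor)
    { app := fun m => g ⊵ₗ F.obj m ≫ S.η m, naturality := fun _ _ f => hnat f } hP hg m

variable (k) in
/-- The effect of the natural transformation on morphisms `Q ⟶ S.x`, evaluated at `P`. -/
def evalMap (S : CenterPair F G) (Q : C) (P : M) :
    (Q ⟶ S.x) →ₗ[k] (Q ⊙ₗ F.obj P ⟶ G.obj P) where
  toFun g := g ⊵ₗ F.obj P ≫ S.η P
  map_add' f g := by rw [add_act k, Preadditive.add_comp]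
  map_smul' r f := by rw [smul_act, Linear.smul_comp]; rfl

lemma evalMap_comp {S T : CenterPair F G} {f : S.x ⟶ T.x} (hf : IsHom S T f) (Q : C) (P : M)
    (g : Q ⟶ S.x) : evalMap k T Q P (g ≫ f) = evalMap k S Q P g := by
  change (g ≫ f) ⊵ₗ F.obj P ≫ T.η P = g ⊵ₗ F.obj P ≫ S.η P
  rw [MonoidalLeftAction.comp_actionHomLeft, Category.assoc, hf.comp]

lemma nonempty (F G : RexFunctor k C M N) : Nonempty (CenterPair F G) :=
  ⟨{ x := 𝟙_ C
     b := (𝟙_ (Center C)).2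
     η := fun m => 0
     nat := by simp
     comm := by simp [act_zero k] }⟩

attribute [local instance] Abelian.hasFiniteBiproducts in
lemma exists_reduced (S : CenterPair F G) {Q : C} (hQ : Projective Q)
    (hQ' : ∀ X : C, ∃ (n : ℕ) (g : Fin n → (Q ⟶ X)),
      ∀ {Y : C} (u v : X ⟶ Y), (∀ i, g i ≫ u = g i ≫ v) → u = v)
    {P : M} (hP : ∀ m : M, ∃ (n : ℕ) (g : Fin n → (P ⟶ m)),
      ∀ {Y : M} (u v : m ⟶ Y), (∀ i, g i ≫ u = g i ≫ v) → u = v) :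
    ∃ (T : CenterPair F G) (q : S.x ⟶ T.x), IsHom S T q ∧
      (evalMap k T Q P).range = (evalMap k S Q P).range ∧
      Function.Injective (evalMap k T Q P) := by
  have := finite_hom k C Q S.x
  obtain ⟨n, g, hg⟩ := Submodule.fg_iff_exists_fin_generating_family.1
    (IsNoetherian.noetherian (LinearMap.ker (evalMap k S Q P)))
  have hgm : ∀ i, evalMap k S Q P (g i) = 0 := fun i => by
    have : g i ∈ LinearMap.ker (evalMap k S Q P) := hg ▸ Submodule.subset_span ⟨i, rfl⟩
    exact this
  let t := biproduct.desc g
  have ht : S.Negligible t := by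
    refine S.negligible_of_generator hP t ?_
    have aR : Functor.Additive (MonoidalLeftAction.actionRight C (F.obj P)) :=
      FiniteModuleCategory.additive_actionRight (k := k) (F.obj P)
    exact map_desc_comp_eq_zero (MonoidalLeftAction.actionRight C (F.obj P)) g (S.η P) hgm
  have hS : ∀ {a' : C} (h : a' ⟶ S.x), S.Negligible h → h ≫ cokernel.π t = 0 := by
    intro a' h hh
    obtain ⟨n', p, hp⟩ := hQ' a'
    refine hp _ _ fun i => ?_
    have hker : p i ≫ h ∈ LinearMap.ker (evalMap k S Q P) := by
      change (p i ≫ h) ⊵ₗ F.obj P ≫ S.η P = 0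
      rw [MonoidalLeftAction.comp_actionHomLeft, Category.assoc, hh, comp_zero]
    rw [comp_zero, ← Category.assoc]
    rw [← hg] at hker
    have hle : Submodule.span k (Set.range g) ≤
        LinearMap.ker (Linear.rightComp k Q (cokernel.π t)) := by
      rw [Submodule.span_le]
      rintro _ ⟨i, rfl⟩
      change g i ≫ cokernel.π t = 0
      have : g i = biproduct.ι (fun _ : Fin n => Q) i ≫ t := (biproduct.ι_desc g i).symm
      rw [this, Category.assoc, cokernel.condition, comp_zero]
    exact hle hker
  obtain ⟨T, q, hq, hepi, hneg⟩ := S.exists_quotient t ht hS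
  refine ⟨T, q, hq, le_antisymm ?_ ?_, ?_⟩
  · rintro _ ⟨f, rfl⟩
    refine ⟨Projective.factorThru f q, ?_⟩
    rw [← evalMap_comp hq, Projective.factorThru_comp]
  · rintro _ ⟨f, rfl⟩
    exact ⟨f ≫ q, evalMap_comp hq Q P f⟩
  · rw [injective_iff_map_eq_zero]
    intro f hf
    rw [← Projective.factorThru_comp f q] at hf ⊢
    rw [evalMap_comp hq] at hf
    exact hneg _ (S.negligible_of_generator hP _ hf)

lemma exists_terminal (F G : RexFunctor k C M N) :
    ∃ T : CenterPair F G, ∀ S : CenterPair F G, ∃! f : S.x ⟶ T.x, IsHom S T f := by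
  obtain ⟨Q, hQ, hQ', -⟩ := exists_generator k C
  obtain ⟨P, -, hP, -⟩ := exists_generator k M
  have := finite_hom k N (Q ⊙ₗ F.obj P) (G.obj P)
  -- choose a pair with maximal range
  obtain ⟨S₀, hS₀⟩ : ∃ S₀ : CenterPair F G, ∀ S : CenterPair F G,
      (evalMap k S₀ Q P).range ≤ (evalMap k S Q P).range →
        (evalMap k S₀ Q P).range = (evalMap k S Q P).range := by
    have hne : (Set.range fun S : CenterPair F G => (evalMap k S Q P).range).Nonempty :=
      ⟨_, ⟨(nonempty F G).some, rfl⟩⟩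
    obtain ⟨_, ⟨S₀, rfl⟩, h⟩ := wellFounded_gt.has_min _ hne
    exact ⟨S₀, fun S hle => le_antisymm hle (by
      by_contra hlt
      exact h _ ⟨S, rfl⟩ (lt_of_le_not_ge hle hlt))⟩
  obtain ⟨T, q, hq, hr, hinj⟩ := S₀.exists_reduced hQ hQ' hP
  refine ⟨T, fun S => ?_⟩
  obtain ⟨U, i, j, hi, hj⟩ := exists_sum T S
  obtain ⟨V, p, hp, hr', hinj'⟩ := U.exists_reduced hQ hQ' hP
  have hrange : (evalMap k T Q P).range = (evalMap k V Q P).range := by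
    rw [hr, hS₀ V]
    rw [← hr]
    rintro _ ⟨f, rfl⟩
    exact ⟨f ≫ i ≫ p, evalMap_comp (hi.trans hp) Q P f⟩
  have hmono : Mono (i ≫ p) := by
    refine Preadditive.mono_of_cancel_zero _ fun {X} f hf => ?_
    obtain ⟨n, g, hg⟩ := hQ' X
    refine hg _ _ fun l => ?_
    rw [comp_zero]
    apply hinj
    rw [← evalMap_comp (hi.trans hp), Category.assoc, hf, comp_zero, map_zero, map_zero]
  have hepi : Epi (i ≫ p) := by
    refine Preadditive.epi_of_cancel_zero _ fun {X} f hf => ?_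
    obtain ⟨n, g, hg⟩ := hQ' V.x
    refine hg _ _ fun l => ?_
    obtain ⟨f', hf'⟩ : evalMap k V Q P (g l) ∈ (evalMap k T Q P).range := hrange ▸ ⟨g l, rfl⟩
    rw [← evalMap_comp (hi.trans hp)] at hf'
    rw [← hinj' hf', comp_zero, Category.assoc, hf, comp_zero]
  have hiso : IsIso (i ≫ p) := isIso_of_mono_of_epi _
  refine ⟨(j ≫ p) ≫ inv (i ≫ p), (hj.trans hp).trans (hi.trans hp).symm, fun f hf => ?_⟩
  obtain ⟨n, g, hg⟩ := hQ' S.x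
  refine hg _ _ fun l => ?_
  apply hinj
  rw [evalMap_comp hf, evalMap_comp ((hj.trans hp).trans (hi.trans hp).symm)]

end Terminal

end CenterPair

section Adjoint

variable [FiniteModuleCategory k C N] {F G : RexFunctor k C M N}

/-- The pair given by a morphism `z . F ⟶ G`. -/
def CenterPair.ofHom (z : Center C) (θ : z ⊙ₗ F ⟶ G) : CenterPair F G where
  x := z.1
  b := z.2
  η m := RexFunctor.app θ m
  nat a := RexFunctor.app_naturality θ a
  comm c m := RexFunctor.app_comm θ c m

/-- The object of the Drinfeld center underlying a pair. -/
def CenterPair.center (S : CenterPair F G) : Center C := ⟨S.x, S.b⟩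

/-- The morphism `z . F ⟶ G` given by a pair. -/
def CenterPair.hom (S : CenterPair F G) : S.center ⊙ₗ F ⟶ G :=
  RexFunctor.mkHom (F := RexFunctor.act S.center F) S.η S.nat S.comm

instance [RigidCategory C] [FiniteTensorCategory k C] [FiniteModuleCategory k C M]
    (F : RexFunctor k C M N) : (MonoidalLeftAction.actionRight (Center C) F).IsLeftAdjoint := by
  have : ∀ G, HasTerminal (CostructuredArrow (MonoidalLeftAction.actionRight (Center C) F) G) := by
    intro G
    obtain ⟨T, hT⟩ := CenterPair.exists_terminal F G
    choose f hf hf' using hT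
    let t : CostructuredArrow (MonoidalLeftAction.actionRight (Center C) F) G :=
      CostructuredArrow.mk (Y := T.center) T.hom
    refine IsTerminal.hasTerminal (X := t) (IsTerminal.ofUniqueHom (fun S =>
      CostructuredArrow.homMk ⟨f (CenterPair.ofHom S.left S.hom), (hf _).comm⟩ ?_) ?_)
    · ext m
      exact (hf (CenterPair.ofHom S.left S.hom)).comp m
    · intro S g
      ext
      exact hf' (CenterPair.ofHom S.left S.hom) _ ⟨g.left.comm, fun m =>
        congrArg (fun e => RexFunctor.app e m) (CostructuredArrow.w g)⟩
  exact isLeftAdjoint_of_costructuredArrowTerminals _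

end Adjoint

end Existence

/-! ### Internal Homs of module categories -/

section InternalHom

variable {A : Type u} [Category.{v} A] [MonoidalCategory A] {X : Type u₁} [Category.{v₁} X]
  [MonoidalLeftAction A X]

/-- The internal Hom `Hom(m, m')`: the value at `m'` of the right adjoint of the functor
`a ↦ a . m`. -/
def intHom (m m' : X) [(MonoidalLeftAction.actionRight A m).IsLeftAdjoint] : A :=
  (MonoidalLeftAction.actionRight A m).rightAdjoint.obj m'

/-- The evaluation `Hom(m, m') . m ⟶ m'`: the counit of the adjunction. -/
def ev (m m' : X) [(MonoidalLeftAction.actionRight A m).IsLeftAdjoint] :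
    intHom (A := A) m m' ⊙ₗ m ⟶ m' :=
  (Adjunction.ofIsLeftAdjoint (MonoidalLeftAction.actionRight A m)).counit.app m'

/-- The adjunct `a ⟶ Hom(m, m')` of a morphism `a . m ⟶ m'`. -/
def transpose {a : A} {m m' : X} [(MonoidalLeftAction.actionRight A m).IsLeftAdjoint]
    (f : a ⊙ₗ m ⟶ m') : a ⟶ intHom (A := A) m m' :=
  (Adjunction.ofIsLeftAdjoint (MonoidalLeftAction.actionRight A m)).homEquiv a m' f

section

variable {a a' : A} {m m' m'' : X} [(MonoidalLeftAction.actionRight A m).IsLeftAdjoint]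

lemma transpose_ev (f : a ⊙ₗ m ⟶ m') : transpose f ⊵ₗ m ≫ ev m m' = f :=
  ((Adjunction.ofIsLeftAdjoint (MonoidalLeftAction.actionRight A m)).homEquiv_counit _ _ _).symm.trans
    (Equiv.symm_apply_apply _ _)

lemma eq_transpose {f : a ⊙ₗ m ⟶ m'} {g : a ⟶ intHom (A := A) m m'} (h : g ⊵ₗ m ≫ ev m m' = f) :
    g = transpose f := by
  subst h
  exact (Equiv.apply_symm_apply _ g).symm.trans (congrArg _
    ((Adjunction.ofIsLeftAdjoint (MonoidalLeftAction.actionRight A m)).homEquiv_counit _ _ _))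

lemma intHom_ext {g g' : a ⟶ intHom (A := A) m m'} (h : g ⊵ₗ m ≫ ev m m' = g' ⊵ₗ m ≫ ev m m') :
    g = g' := (eq_transpose h).trans (eq_transpose rfl).symm

lemma comp_transpose (g : a' ⟶ a) (f : a ⊙ₗ m ⟶ m') :
    g ≫ transpose f = transpose (g ⊵ₗ m ≫ f) := by
  apply eq_transpose
  rw [MonoidalLeftAction.comp_actionHomLeft, Category.assoc, transpose_ev]

lemma transpose_ev_self : transpose (ev (A := A) m m') = 𝟙 _ :=
  (eq_transpose (by simp)).symm

end

/-- The multiplication `Hom(m', m'') ⊗ Hom(m, m') ⟶ Hom(m, m'')` of internal Homs. -/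
def intComp (m m' m'' : X) [(MonoidalLeftAction.actionRight A m).IsLeftAdjoint]
    [(MonoidalLeftAction.actionRight A m').IsLeftAdjoint] :
    intHom (A := A) m' m'' ⊗ intHom (A := A) m m' ⟶ intHom (A := A) m m'' :=
  transpose ((αₗ _ _ m).hom ≫ intHom (A := A) m' m'' ⊴ₗ ev m m' ≫ ev m' m'')

end InternalHom

/-! ### Internal natural transformations -/

section Nat

variable {k : Type w} [Field k] {C : Type u} [Category.{v} C] [Abelian C] [Linear k C]
  [MonoidalCategory C] [RigidCategory C] [FiniteTensorCategory k C]
  {M₁ : Type u₁} [Category.{v₁} M₁] [Abelian M₁] [Linear k M₁] [MonoidalLeftAction C M₁]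
  [FiniteModuleCategory k C M₁]
  {M₂ : Type u₂} [Category.{v₂} M₂] [Abelian M₂] [Linear k M₂] [MonoidalLeftAction C M₂]
  [FiniteModuleCategory k C M₂]
  {M₃ : Type u₃} [Category.{v₃} M₃] [Abelian M₃] [Linear k M₃] [MonoidalLeftAction C M₃]
  [FiniteModuleCategory k C M₃]

/-- The object of internal natural transformations from `F` to `G`: the internal Hom of `F` and `G`
in the module category `Rex_C(M₁, M₂)` over the Drinfeld center of `C`. -/
abbrev NatObj (F G : RexFunctor k C M₁ M₂) : Center C := intHom (A := Center C) F G

/-- The vertical composition of internal natural transformations: the multiplication of internal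
Homs of `Rex_C(M₁, M₂)`. -/
def verComp (F G H : RexFunctor k C M₁ M₂) : NatObj G H ⊗ NatObj F G ⟶ NatObj F H :=
  intComp (A := Center C) F G H

/-! #### Internal natural transformations as a coend -/

/-- A dinatural family `Hom(z . F, G) ⊗ₖ z ⟶ T`, for `z` in the Drinfeld center of `C`. A morphism
from `V ⊗ₖ z`, with `V` a vector space, to `T` is the same as a linear map from `V` to
`Hom(z, T)`. -/
structure DinatFamily (F G : RexFunctor k C M₁ M₂) (T : Center C) where
  ι (z : Center C) : (z ⊙ₗ F ⟶ G) →ₗ[k] (z ⟶ T)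
  dinatural {z z' : Center C} (f : z ⟶ z') (φ : z' ⊙ₗ F ⟶ G) :
    ι z (f ⊵ₗ F ≫ φ) = f ≫ ι z' φ

lemma add_actRex {z z' : Center C} (f g : z ⟶ z') (F : RexFunctor k C M₁ M₂) :
    (f + g) ⊵ₗ F = f ⊵ₗ F + g ⊵ₗ F := by
  ext m
  exact add_act k f.f g.f (F.obj m)

lemma smul_actRex {z z' : Center C} (r : k) (f : z ⟶ z') (F : RexFunctor k C M₁ M₂) :
    (r • f) ⊵ₗ F = r • f ⊵ₗ F := by
  ext m
  exact smul_act k r f.f (F.obj m)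

lemma actRex_add (z : Center C) {F G : RexFunctor k C M₁ M₂} (f g : F ⟶ G) :
    z ⊴ₗ (f + g) = z ⊴ₗ f + z ⊴ₗ g := by
  ext m
  exact act_add k z.1 (RexFunctor.app f m) (RexFunctor.app g m)

lemma actRex_smul (z : Center C) {F G : RexFunctor k C M₁ M₂} (r : k) (f : F ⟶ G) :
    z ⊴ₗ (r • f) = r • z ⊴ₗ f := by
  ext m
  exact act_smul k z.1 r (RexFunctor.app f m)

lemma transpose_add {z : Center C} {F G : RexFunctor k C M₁ M₂} (φ ψ : z ⊙ₗ F ⟶ G) :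
    transpose (φ + ψ) = transpose φ + transpose ψ := by
  refine (eq_transpose ?_).symm
  rw [add_actRex, Preadditive.add_comp, transpose_ev, transpose_ev]

lemma transpose_smul {z : Center C} {F G : RexFunctor k C M₁ M₂} (r : k) (φ : z ⊙ₗ F ⟶ G) :
    transpose (r • φ) = r • transpose φ := by
  refine (eq_transpose ?_).symm
  rw [smul_actRex, Linear.smul_comp, transpose_ev]

/-- The structure family of the coend: it sends `z . F ⟶ G` to its adjunct `z ⟶ Nat(F, G)`. -/
def natFamily (F G : RexFunctor k C M₁ M₂) : DinatFamily F G (NatObj F G) where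
  ι z :=
    { toFun := fun φ => transpose φ
      map_add' := transpose_add
      map_smul' := transpose_smul }
  dinatural f φ := (comp_transpose f φ).symm

/-- `Nat(F, G)` is the coend of `Hom(z . F, G) ⊗ₖ z`. -/
lemma natFamily_universal (F G : RexFunctor k C M₁ M₂) {T : Center C} (κ : DinatFamily F G T) :
    ∃! h : NatObj F G ⟶ T, ∀ (z : Center C) (φ : z ⊙ₗ F ⟶ G),
      (natFamily F G).ι z φ ≫ h = κ.ι z φ := by
  refine ⟨κ.ι (NatObj F G) (ev F G), fun z φ => ?_, fun h hh => ?_⟩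
  · rw [← κ.dinatural]
    exact congrArg (κ.ι z) (transpose_ev φ)
  · rw [← hh]
    exact (Category.id_comp h).symm.trans (congrArg (· ≫ h) transpose_ev_self.symm)

/-- A dinatural family `Hom(z . G, G') ⊗ₖ Hom(z' . F, F') ⊗ₖ (z ⊗ z') ⟶ T`. -/
structure DinatFamily₂ (G G' : RexFunctor k C M₂ M₃) (F F' : RexFunctor k C M₁ M₂)
    (T : Center C) where
  ι (z z' : Center C) : (z ⊙ₗ G ⟶ G') →ₗ[k] (z' ⊙ₗ F ⟶ F') →ₗ[k] (z ⊗ z' ⟶ T)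
  dinatural {z₁ z₂ z₁' z₂' : Center C} (f : z₁ ⟶ z₂) (f' : z₁' ⟶ z₂') (φ : z₂ ⊙ₗ G ⟶ G')
    (ψ : z₂' ⊙ₗ F ⟶ F') : ι z₁ z₁' (f ⊵ₗ G ≫ φ) (f' ⊵ₗ F ≫ ψ) = (f ⊗ₘ f') ≫ ι z₂ z₂' φ ψ

/-- The morphism out of the double coend `Nat(G, G') ⊗ Nat(F, F')` given by a dinatural family. -/
def DinatFamily₂.desc {G G' : RexFunctor k C M₂ M₃} {F F' : RexFunctor k C M₁ M₂} {T : Center C}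
    (κ : DinatFamily₂ G G' F F' T) : NatObj G G' ⊗ NatObj F F' ⟶ T :=
  κ.ι (NatObj G G') (NatObj F F') (ev G G') (ev F F')

lemma DinatFamily₂.ι_desc {G G' : RexFunctor k C M₂ M₃} {F F' : RexFunctor k C M₁ M₂}
    {T : Center C} (κ : DinatFamily₂ G G' F F' T) (z z' : Center C) (φ : z ⊙ₗ G ⟶ G')
    (ψ : z' ⊙ₗ F ⟶ F') :
    ((natFamily G G').ι z φ ⊗ₘ (natFamily F F').ι z' ψ) ≫ κ.desc = κ.ι z z' φ ψ := by
  refine (κ.dinatural (transpose φ) (transpose ψ) (ev G G') (ev F F')).symm.trans ?_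
  rw [transpose_ev, transpose_ev]

lemma DinatFamily₂.desc_unique {G G' : RexFunctor k C M₂ M₃} {F F' : RexFunctor k C M₁ M₂}
    {T : Center C} (κ : DinatFamily₂ G G' F F' T) (h : NatObj G G' ⊗ NatObj F F' ⟶ T)
    (hh : ∀ (z z' : Center C) (φ : z ⊙ₗ G ⟶ G') (ψ : z' ⊙ₗ F ⟶ F'),
      ((natFamily G G').ι z φ ⊗ₘ (natFamily F F').ι z' ψ) ≫ h = κ.ι z z' φ ψ) : h = κ.desc := by
  refine Eq.trans ?_ (hh (NatObj G G') (NatObj F F') (ev G G') (ev F F'))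
  have h1 : (natFamily G G').ι _ (ev G G') = 𝟙 (NatObj G G') := transpose_ev_self
  have h2 : (natFamily F F').ι _ (ev F F') = 𝟙 (NatObj F F') := transpose_ev_self
  rw [h1, h2, id_tensorHom_id, Category.id_comp]

end Nat

section HorizontalComposition

variable {k : Type w} [Field k] {C : Type u} [Category.{v} C] [Abelian C] [Linear k C]
  [MonoidalCategory C] [RigidCategory C] [FiniteTensorCategory k C]
  {M₁ : Type u₁} [Category.{v₁} M₁] [Abelian M₁] [Linear k M₁] [MonoidalLeftAction C M₁]
  [FiniteModuleCategory k C M₁]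
  {M₂ : Type u₂} [Category.{v₂} M₂] [Abelian M₂] [Linear k M₂] [MonoidalLeftAction C M₂]
  [FiniteModuleCategory k C M₂]
  {M₃ : Type u₃} [Category.{v₃} M₃] [Abelian M₃] [Linear k M₃] [MonoidalLeftAction C M₃]
  [FiniteModuleCategory k C M₃]

/-! #### Horizontal composition -/

namespace RexFunctor

lemma map_comp' (F : RexFunctor k C M₁ M₂) {m m' m'' : M₁} (f : m ⟶ m') (g : m' ⟶ m'') :
    F.map (f ≫ g) = F.map f ≫ F.map g := F.toFunctor.map_comp f g

lemma map_comp_assoc' (F : RexFunctor k C M₁ M₂) {m m' m'' : M₁} (f : m ⟶ m') (g : m' ⟶ m'')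
    {n : M₂} (h : F.obj m'' ⟶ n) : F.map (f ≫ g) ≫ h = F.map f ≫ F.map g ≫ h :=
  F.toFunctor.map_comp_assoc f g h

/-- The ordinary horizontal composition of module natural transformations. -/
def hcomp {G G' : RexFunctor k C M₂ M₃} {F F' : RexFunctor k C M₁ M₂} (φ : G ⟶ G') (ψ : F ⟶ F') :
    comp G F ⟶ comp G' F' :=
  mkHom (F := comp G F) (G := comp G' F') (fun m => G.map (app ψ m) ≫ app φ (F'.obj m))
    (fun {m m'} a => by
      change G.map (F.map a) ≫ G.map (app ψ m') ≫ app φ (F'.obj m') =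
        (G.map (app ψ m) ≫ app φ (F'.obj m)) ≫ G'.map (F'.map a)
      rw [Category.assoc, ← app_naturality φ, ← map_comp_assoc', ← map_comp_assoc',
        app_naturality ψ])
    (fun c m => by
      change (G.map (δₗ F.toFunctor c m) ≫ δₗ G.toFunctor c (F.obj m)) ≫
          c ⊴ₗ (G.map (app ψ m) ≫ app φ (F'.obj m)) =
        (G.map (app ψ (c ⊙ₗ m)) ≫ app φ (F'.obj (c ⊙ₗ m))) ≫
          G'.map (δₗ F'.toFunctor c m) ≫ δₗ G'.toFunctor c (F'.obj m)
      rw [MonoidalLeftAction.actionHomRight_comp, Category.assoc, Category.assoc,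
        ← δₗ_naturality_right_assoc, app_comm, ← reassoc_of% app_naturality φ,
        ← Functor.map_comp_assoc, ← Functor.map_comp_assoc, app_comm])

lemma hcomp_comp {G G' G'' : RexFunctor k C M₂ M₃} {F F' F'' : RexFunctor k C M₁ M₂} (φ : G ⟶ G')
    (φ' : G' ⟶ G'') (ψ : F ⟶ F') (ψ' : F' ⟶ F'') :
    hcomp (φ ≫ φ') (ψ ≫ ψ') = hcomp φ ψ ≫ hcomp φ' ψ' := by
  ext m
  change G.map (app ψ m ≫ app ψ' m) ≫ app φ (F''.obj m) ≫ app φ' (F''.obj m) =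
    (G.map (app ψ m) ≫ app φ (F'.obj m)) ≫ G'.map (app ψ' m) ≫ app φ' (F''.obj m)
  rw [map_comp', Category.assoc, Category.assoc, reassoc_of% app_naturality φ]

lemma slide_δ (G : RexFunctor k C M₂ M₃) {x : C} (b : HalfBraiding x) (c : C) (n : M₂) :
    G.map (slide b c n).hom ≫ δₗ G.toFunctor c (x ⊙ₗ n) ≫ c ⊴ₗ δₗ G.toFunctor x n =
      δₗ G.toFunctor x (c ⊙ₗ n) ≫ x ⊴ₗ δₗ G.toFunctor c n ≫ (slide b c (G.obj n)).hom := by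
  have h1 := δₗ_associativity G.toFunctor c x n
  have h2 := δₗ_associativity G.toFunctor x c n
  have h2' := G.toFunctor.map (αₗ x c n).inv ≫= h2
  rw [← Functor.map_comp_assoc, Iso.inv_hom_id, CategoryTheory.Functor.map_id, Category.id_comp] at h2'
  simp only [slide_hom, Functor.map_comp, Category.assoc]
  rw [← h1, δₗ_naturality_left_assoc, ← reassoc_of% h2', Iso.hom_inv_id_assoc]

section Raw

variable {x x' : C} (b : HalfBraiding x) (b' : HalfBraiding x') (b'' : HalfBraiding (x ⊗ x'))

lemma raw_hcomp (hb : ∀ c, (b''.β c).hom = (α_ x x' c).hom ≫ x ◁ (b'.β c).hom ≫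
      (α_ x c x').inv ≫ (b.β c).hom ▷ x' ≫ (α_ c x x').hom)
    (G : RexFunctor k C M₂ M₃) (F : RexFunctor k C M₁ M₂) (c : C) (m : M₁) :
    (x ⊴ₗ G.map (x' ⊴ₗ δₗ F.toFunctor c m ≫ (slide b' c (F.obj m)).hom) ≫
      x ⊴ₗ δₗ G.toFunctor c (x' ⊙ₗ F.obj m) ≫ (slide b c (G.obj (x' ⊙ₗ F.obj m))).hom) ≫
        c ⊴ₗ (x ⊴ₗ δₗ G.toFunctor x' (F.obj m) ≫ (αₗ x x' (G.obj (F.obj m))).inv) =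
    (x ⊴ₗ δₗ G.toFunctor x' (F.obj (c ⊙ₗ m)) ≫ (αₗ x x' (G.obj (F.obj (c ⊙ₗ m)))).inv) ≫
      (x ⊗ x') ⊴ₗ (G.map (δₗ F.toFunctor c m) ≫ δₗ G.toFunctor c (F.obj m)) ≫
        (slide b'' c (G.obj (F.obj m))).hom := by
  have h1 : (αₗ x x' (c ⊙ₗ G.obj (F.obj m))).inv ≫ (slide b'' c (G.obj (F.obj m))).hom =
      x ⊴ₗ (slide b' c (G.obj (F.obj m))).hom ≫ (slide b c (x' ⊙ₗ G.obj (F.obj m))).hom ≫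
        c ⊴ₗ (αₗ x x' (G.obj (F.obj m))).inv := by
    rw [Iso.inv_comp_eq, reassoc_of% slide_tensor (b := b) (b' := b') hb c (G.obj (F.obj m))]
    simp [-slide_hom]
  have h2 : (αₗ x x' (G.obj (F.obj (c ⊙ₗ m)))).inv ≫ (x ⊗ x') ⊴ₗ (G.map (δₗ F.toFunctor c m) ≫
        δₗ G.toFunctor c (F.obj m)) = x ⊴ₗ (x' ⊴ₗ G.map (δₗ F.toFunctor c m) ≫
          x' ⊴ₗ δₗ G.toFunctor c (F.obj m)) ≫ (αₗ x x' (c ⊙ₗ G.obj (F.obj m))).inv := by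
    simp
  rw [Category.assoc, Category.assoc, Category.assoc, reassoc_of% h2, h1,
    MonoidalLeftAction.actionHomRight_comp,
    ← reassoc_of% slide_naturality_right b c (δₗ G.toFunctor x' (F.obj m)), map_comp',
    ← MonoidalLeftAction.actionHomRight_comp_assoc, ← MonoidalLeftAction.actionHomRight_comp_assoc,
    ← MonoidalLeftAction.actionHomRight_comp_assoc, ← MonoidalLeftAction.actionHomRight_comp_assoc]
  simp only [Category.assoc]
  rw [slide_δ G b' c (F.obj m), δₗ_naturality_right_assoc]

/-- The isomorphism `(x . G) ∘ (x' . F) ≅ (x ⊗ x') . (G ∘ F)` given by the module functor constraint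
of `G`. -/
def hcompIsoRaw (hb : ∀ c, (b''.β c).hom = (α_ x x' c).hom ≫ x ◁ (b'.β c).hom ≫
      (α_ x c x').inv ≫ (b.β c).hom ▷ x' ≫ (α_ c x x').hom)
    (G : RexFunctor k C M₂ M₃) (F : RexFunctor k C M₁ M₂) :
    comp (actRaw b G) (actRaw b' F) ≅ actRaw b'' (comp G F) :=
  mkIso (F := comp (actRaw b G) (actRaw b' F)) (G := actRaw b'' (comp G F))
    (fun m => (MonoidalLeftAction.actionLeft M₃ x).mapIso (G.φ x' (F.obj m)) ≪≫
      (αₗ x x' (G.obj (F.obj m))).symm)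
    (fun {m m'} a => by
      change x ⊴ₗ G.map (x' ⊴ₗ F.map a) ≫ x ⊴ₗ δₗ G.toFunctor x' (F.obj m') ≫
          (αₗ x x' (G.obj (F.obj m'))).inv =
        (x ⊴ₗ δₗ G.toFunctor x' (F.obj m) ≫ (αₗ x x' (G.obj (F.obj m))).inv) ≫
          (x ⊗ x') ⊴ₗ G.map (F.map a)
      rw [← MonoidalLeftAction.actionHomRight_comp_assoc, δₗ_naturality_right]
      simp)
    (fun c m => raw_hcomp b b' b'' hb G F c m)

end Raw

/-- The isomorphism `(z . G) ∘ (z' . F) ≅ (z ⊗ z') . (G ∘ F)` given by the module functor constraint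
of `G`. -/
def hcompIso (z z' : Center C) (G : RexFunctor k C M₂ M₃) (F : RexFunctor k C M₁ M₂) :
    comp (z ⊙ₗ G) (z' ⊙ₗ F) ≅ (z ⊗ z') ⊙ₗ comp G F :=
  hcompIsoRaw z.2 z'.2 (z ⊗ z').2 (fun _ => rfl) G F

/-- The modified horizontal composition
`(z ⊗ z') . (G ∘ F) ≅ (z . G) ∘ (z' . F) ⟶ G' ∘ F'`. -/
def modifiedHcomp {z z' : Center C} {G G' : RexFunctor k C M₂ M₃} {F F' : RexFunctor k C M₁ M₂}
    (φ : z ⊙ₗ G ⟶ G') (ψ : z' ⊙ₗ F ⟶ F') : (z ⊗ z') ⊙ₗ comp G F ⟶ comp G' F' :=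
  (hcompIso z z' G F).inv ≫ hcomp φ ψ

lemma raw_hcomp_naturality {x₁ x₂ x₁' x₂' : C} (f : x₁ ⟶ x₂) (f' : x₁' ⟶ x₂')
    (G : RexFunctor k C M₂ M₃) (n : M₂) :
    (x₁ ⊴ₗ G.map (f' ⊵ₗ n) ≫ f ⊵ₗ G.obj (x₂' ⊙ₗ n)) ≫
        x₂ ⊴ₗ δₗ G.toFunctor x₂' n ≫ (αₗ x₂ x₂' (G.obj n)).inv =
      (x₁ ⊴ₗ δₗ G.toFunctor x₁' n ≫ (αₗ x₁ x₁' (G.obj n)).inv) ≫ (f ⊗ₘ f') ⊵ₗ G.obj n := by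
  rw [Category.assoc, MonoidalLeftAction.action_exchange_assoc,
    ← MonoidalLeftAction.actionHomRight_comp_assoc, δₗ_naturality_left, MonoidalCategory.tensorHom_def]
  simp only [MonoidalLeftAction.whiskerRight_actionHomLeft, MonoidalLeftAction.comp_actionHomLeft,
    MonoidalLeftAction.whiskerLeft_actionHomLeft, Category.assoc, Iso.inv_hom_id_assoc,
    MonoidalLeftAction.actionHomRight_comp]
  rw [MonoidalLeftAction.action_exchange_assoc]

lemma hcompIso_naturality {z₁ z₂ z₁' z₂' : Center C} (f : z₁ ⟶ z₂) (f' : z₁' ⟶ z₂')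
    (G : RexFunctor k C M₂ M₃) (F : RexFunctor k C M₁ M₂) :
    hcomp (f ⊵ₗ G) (f' ⊵ₗ F) ≫ (hcompIso z₂ z₂' G F).hom =
      (hcompIso z₁ z₁' G F).hom ≫ (f ⊗ₘ f') ⊵ₗ comp G F := by
  ext m
  exact raw_hcomp_naturality f.f f'.f G (F.obj m)

lemma modifiedHcomp_dinatural {z₁ z₂ z₁' z₂' : Center C} {G G' : RexFunctor k C M₂ M₃}
    {F F' : RexFunctor k C M₁ M₂} (f : z₁ ⟶ z₂) (f' : z₁' ⟶ z₂') (φ : z₂ ⊙ₗ G ⟶ G')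
    (ψ : z₂' ⊙ₗ F ⟶ F') :
    modifiedHcomp (f ⊵ₗ G ≫ φ) (f' ⊵ₗ F ≫ ψ) = (f ⊗ₘ f') ⊵ₗ comp G F ≫ modifiedHcomp φ ψ := by
  rw [modifiedHcomp, modifiedHcomp, hcomp_comp, Iso.inv_comp_eq,
    ← reassoc_of% hcompIso_naturality f f' G F, Iso.hom_inv_id_assoc]

section Bilinear

variable {G G' : RexFunctor k C M₂ M₃} {F F' : RexFunctor k C M₁ M₂}

lemma hcomp_add (φ : G ⟶ G') (ψ ψ' : F ⟶ F') : hcomp φ (ψ + ψ') = hcomp φ ψ + hcomp φ ψ' := by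
  ext m
  change G.toFunctor.map (app ψ m + app ψ' m) ≫ app φ (F'.obj m) =
    G.toFunctor.map (app ψ m) ≫ app φ (F'.obj m) + G.toFunctor.map (app ψ' m) ≫ app φ (F'.obj m)
  rw [Functor.map_add, Preadditive.add_comp]

lemma add_hcomp (φ φ' : G ⟶ G') (ψ : F ⟶ F') : hcomp (φ + φ') ψ = hcomp φ ψ + hcomp φ' ψ := by
  ext m
  exact Preadditive.comp_add _ _ _ _ _ _

lemma hcomp_smul (r : k) (φ : G ⟶ G') (ψ : F ⟶ F') : hcomp φ (r • ψ) = r • hcomp φ ψ := by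
  ext m
  change G.toFunctor.map (r • app ψ m) ≫ app φ (F'.obj m) =
    r • (G.toFunctor.map (app ψ m) ≫ app φ (F'.obj m))
  rw [Functor.map_smul, Linear.smul_comp]

lemma smul_hcomp (r : k) (φ : G ⟶ G') (ψ : F ⟶ F') : hcomp (r • φ) ψ = r • hcomp φ ψ := by
  ext m
  exact Linear.comp_smul _ _ _ _ _ _

/-- The modified horizontal composition as a bilinear map. -/
def modifiedHcompₗ (z z' : Center C) (G G' : RexFunctor k C M₂ M₃) (F F' : RexFunctor k C M₁ M₂) :
    (z ⊙ₗ G ⟶ G') →ₗ[k] (z' ⊙ₗ F ⟶ F') →ₗ[k] ((z ⊗ z') ⊙ₗ comp G F ⟶ comp G' F') :=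
  LinearMap.mk₂ k modifiedHcomp
    (fun φ φ' ψ => by
      rw [modifiedHcomp, add_hcomp, Preadditive.comp_add, modifiedHcomp, modifiedHcomp])
    (fun r φ ψ => by rw [modifiedHcomp, smul_hcomp, Linear.comp_smul, modifiedHcomp])
    (fun φ ψ ψ' => by
      rw [modifiedHcomp, hcomp_add, Preadditive.comp_add, modifiedHcomp, modifiedHcomp])
    (fun r φ ψ => by rw [modifiedHcomp, hcomp_smul, Linear.comp_smul, modifiedHcomp])

end Bilinear

end RexFunctor

/-- The dinatural family defining the horizontal composition: the modified horizontal composition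
`Hom(z . G, G') ⊗ₖ Hom(z' . F, F') ⟶ Hom((z ⊗ z') . (G ∘ F), G' ∘ F')` followed by the structure
morphism of the coend `Nat(G ∘ F, G' ∘ F')` at `z ⊗ z'`. -/
def horFamily (G G' : RexFunctor k C M₂ M₃) (F F' : RexFunctor k C M₁ M₂) :
    DinatFamily₂ G G' F F' (NatObj (RexFunctor.comp G F) (RexFunctor.comp G' F')) where
  ι z z' := (RexFunctor.modifiedHcompₗ z z' G G' F F').compr₂
    ((natFamily (RexFunctor.comp G F) (RexFunctor.comp G' F')).ι (z ⊗ z'))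
  dinatural {z₁ z₂ z₁' z₂'} f f' φ ψ := by
    refine Eq.trans ?_ ((natFamily _ _).dinatural (f ⊗ₘ f') (RexFunctor.modifiedHcomp φ ψ))
    exact congrArg ((natFamily (RexFunctor.comp G F) (RexFunctor.comp G' F')).ι (z₁ ⊗ z₁'))
      (RexFunctor.modifiedHcomp_dinatural f f' φ ψ)

/-- The horizontal composition of internal natural transformations: the morphism out of the coend
`Nat(G, G') ⊗ Nat(F, F')` given by the dinatural family `horFamily`. -/
def horComp (G G' : RexFunctor k C M₂ M₃) (F F' : RexFunctor k C M₁ M₂) :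
    NatObj G G' ⊗ NatObj F F' ⟶ NatObj (RexFunctor.comp G F) (RexFunctor.comp G' F') :=
  (horFamily G G' F F').desc

/-- `(W ⊗ X) ⊗ (Y ⊗ Z) ⟶ (W ⊗ Y) ⊗ (X ⊗ Z)`, exchanging the middle factors by the braiding
`X ⊗ Y ≅ Y ⊗ X` of the Drinfeld center. -/
def middleBraiding {C : Type u} [Category.{v} C] [MonoidalCategory C] (W X Y Z : Center C) :
    (W ⊗ X) ⊗ (Y ⊗ Z) ⟶ (W ⊗ Y) ⊗ (X ⊗ Z) :=
  (α_ W X (Y ⊗ Z)).hom ≫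
    W ◁ ((α_ X Y Z).inv ≫ (centerBraiding X Y).hom ▷ Z ≫ (α_ Y X Z).hom) ≫
      (α_ W Y (X ⊗ Z)).inv

end HorizontalComposition

end InternalNat

end

/-!
The interchange law is an identity of morphisms into an internal Hom, so it may be checked after
acting on `F' ∘ F` and composing with the evaluation. There the vertical composition becomes
`RexFunctor.vcomp`, the composite of `p : w . G ⟶ H` with `r : y . F ⟶ G`, and the horizontal
composition becomes `RexFunctor.modifiedHcomp` (`verComp_ev`, `horComp_ev`). Both operations are
natural in the objects of the center, so what has to be shown is an interchange law for four module
natural transformations `p : w . G' ⟶ H'`, `q : x . G ⟶ H`, `r : y . F' ⟶ G'`, `s : z . F ⟶ G`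
(`RexFunctor.vcomp_modifiedHcomp`).

On components, the two sides differ in the order in which `r` and the constraints that move `x` into
the functors `F'` and `G'` are applied: one side applies `r` and moves `x` into `G'`, the other moves
`x` into `F'` and applies `r`. Since `r` is a *module* natural transformation out of `y . F'`, whose
constraint contains the half-braiding of `y`, passing from one order to the other costs precisely
the inverse half-braiding `x ⊗ y ⟶ y ⊗ x` of `y`, that is, the braiding of the center. The rest is
naturality, the compatibility of the constraint of `F'` with `x ⊗ z`, and the coherence identity
`middleExchange_action` for the mixed associators.
-/

noncomputable section

namespace InternalNat

open Functor.LaxLeftLinear Functor.OplaxLeftLinear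

lemma middleBraiding_f {C : Type u} [Category.{v} C] [MonoidalCategory C] (w x y z : Center C) :
    (middleBraiding w x y z).f = (α_ w.1 x.1 (y.1 ⊗ z.1)).hom ≫
      w.1 ◁ ((α_ x.1 y.1 z.1).inv ≫ (y.2.β x.1).inv ▷ z.1 ≫ (α_ y.1 x.1 z.1).hom) ≫
        (α_ w.1 y.1 (x.1 ⊗ z.1)).inv := by
  rw [← centerBraiding_hom_f]
  simp only [middleBraiding, Center.comp_f, Center.whiskerLeft_f, Center.whiskerRight_f,
    Center.associator_hom_f, Center.associator_inv_f]
  rfl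

section Coherence

variable {C : Type u} [Category.{v} C] [MonoidalCategory C]
  {N : Type u₂} [Category.{v₂} N] [Abelian N] [MonoidalLeftAction C N]

/-- Exchanging the middle factors of `(w ⊗ x) ⊗ (y ⊗ z)` by `t`, and then letting the four factors
act on `n` one after the other, is the same as first passing to `w . x . y . z . n` and exchanging
`x` and `y` there. -/
lemma middleExchange_action {x y : C} (t : x ⊗ y ⟶ y ⊗ x) (w z : C) (n : N) :
    ((α_ w x (y ⊗ z)).hom ≫ w ◁ ((α_ x y z).inv ≫ t ▷ z ≫ (α_ y x z).hom) ≫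
        (α_ w y (x ⊗ z)).inv) ⊵ₗ n ≫
      (αₗ (w ⊗ y) (x ⊗ z) n).hom ≫ (αₗ w y ((x ⊗ z) ⊙ₗ n)).hom ≫ w ⊴ₗ y ⊴ₗ (αₗ x z n).hom =
    (αₗ (w ⊗ x) (y ⊗ z) n).hom ≫ (αₗ w x ((y ⊗ z) ⊙ₗ n)).hom ≫
      w ⊴ₗ (x ⊴ₗ (αₗ y z n).hom ≫ (αₗ x y (z ⊙ₗ n)).inv ≫ t ⊵ₗ (z ⊙ₗ n) ≫
        (αₗ y x (z ⊙ₗ n)).hom) := by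
  have h₁ := act_pentagon y x z n (𝟙 _)
  have h₂ := act_pentagon' x y z n (αₗ x y (z ⊙ₗ n)).inv
  simp only [Category.comp_id, Iso.hom_inv_id] at h₁ h₂
  rw [act_pentagon w x (y ⊗ z) n]
  simp only [MonoidalLeftAction.comp_actionHomLeft, Category.assoc]
  rw [act_pentagon']
  simp only [MonoidalLeftAction.whiskerLeft_actionHomLeft, Category.assoc, Iso.inv_hom_id_assoc]
  simp only [← MonoidalLeftAction.actionHomRight_comp]
  rw [← reassoc_of% h₂]
  simp only [MonoidalLeftAction.comp_actionHomLeft, Category.assoc, ← h₁,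
    MonoidalLeftAction.whiskerRight_actionHomLeft, Iso.inv_hom_id_assoc]

end Coherence

section Interchange

variable {k : Type w} [Field k] {C : Type u} [Category.{v} C] [Abelian C] [Linear k C]
  [MonoidalCategory C] [RigidCategory C] [FiniteTensorCategory k C]
  {M₁ : Type u₁} [Category.{v₁} M₁] [Abelian M₁] [Linear k M₁] [MonoidalLeftAction C M₁]
  [FiniteModuleCategory k C M₁]
  {M₂ : Type u₂} [Category.{v₂} M₂] [Abelian M₂] [Linear k M₂] [MonoidalLeftAction C M₂]
  [FiniteModuleCategory k C M₂]
  {M₃ : Type u₃} [Category.{v₃} M₃] [Abelian M₃] [Linear k M₃] [MonoidalLeftAction C M₃]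
  [FiniteModuleCategory k C M₃]

namespace RexFunctor

/-- The composite `(w ⊗ y) . F ≅ w . (y . F) ⟶ w . G ⟶ H` of `p : w . G ⟶ H` and
`r : y . F ⟶ G`. -/
def vcomp {w y : Center C} {F G H : RexFunctor k C M₁ M₂} (p : w ⊙ₗ G ⟶ H) (r : y ⊙ₗ F ⟶ G) :
    (w ⊗ y) ⊙ₗ F ⟶ H :=
  (αₗ w y F).hom ≫ w ⊴ₗ r ≫ p

lemma app_modifiedHcomp {w x : Center C} {F G : RexFunctor k C M₁ M₂}
    {F' G' : RexFunctor k C M₂ M₃} (p : w ⊙ₗ F' ⟶ G') (q : x ⊙ₗ F ⟶ G) (m : M₁) :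
    app (modifiedHcomp p q) m =
      (αₗ w.1 x.1 (F'.obj (F.obj m))).hom ≫
        w.1 ⊴ₗ (μₗ F'.toFunctor x.1 (F.obj m) ≫ F'.map (app q m)) ≫ app p (G.obj m) := by
  refine Eq.trans (b := ((αₗ w.1 x.1 (F'.obj (F.obj m))).hom ≫
    w.1 ⊴ₗ μₗ F'.toFunctor x.1 (F.obj m)) ≫ w.1 ⊴ₗ F'.map (app q m) ≫ app p (G.obj m)) rfl ?_
  refine (Category.assoc _ _ _).trans (congrArg (_ ≫ ·) ?_)
  exact (MonoidalLeftAction.actionHomRight_comp_assoc _ _ _ _).symm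

/-- The interchange law on components, for a module natural transformation `S.η` from `S.x . F'` to
`G'`. Only the underlying objects of `w`, `x` and `z` enter, and only the half-braiding of `S.x`. -/
lemma raw_interchange {F' G' : RexFunctor k C M₂ M₃} (S : CenterPair F' G') {w x z : C}
    {n₀ n₁ n₂ : M₂} (s : z ⊙ₗ n₀ ⟶ n₁) (q : x ⊙ₗ n₁ ⟶ n₂) {t : M₃} (p : w ⊙ₗ G'.obj n₂ ⟶ t) :
    (αₗ (w ⊗ x) (S.x ⊗ z) (F'.obj n₀)).hom ≫
      (w ⊗ x) ⊴ₗ ((αₗ S.x z (F'.obj n₀)).hom ≫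
        S.x ⊴ₗ (μₗ F'.toFunctor z n₀ ≫ F'.map s) ≫ S.η n₁) ≫
      (αₗ w x (G'.obj n₁)).hom ≫ w ⊴ₗ (μₗ G'.toFunctor x n₁ ≫ G'.map q) ≫ p =
    ((α_ w x (S.x ⊗ z)).hom ≫
        w ◁ ((α_ x S.x z).inv ≫ (S.b.β x).inv ▷ z ≫ (α_ S.x x z).hom) ≫
          (α_ w S.x (x ⊗ z)).inv) ⊵ₗ F'.obj n₀ ≫
      (αₗ (w ⊗ S.x) (x ⊗ z) (F'.obj n₀)).hom ≫
        (w ⊗ S.x) ⊴ₗ (μₗ F'.toFunctor (x ⊗ z) n₀ ≫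
          F'.map ((αₗ x z n₀).hom ≫ x ⊴ₗ s ≫ q)) ≫
        (αₗ w S.x (F'.obj n₂)).hom ≫ w ⊴ₗ S.η n₂ ≫ p := by
  have hμ : μₗ F'.toFunctor (x ⊗ z) n₀ ≫ F'.map ((αₗ x z n₀).hom ≫ x ⊴ₗ s ≫ q) =
      (αₗ x z (F'.obj n₀)).hom ≫ x ⊴ₗ (μₗ F'.toFunctor z n₀ ≫ F'.map s) ≫
        μₗ F'.toFunctor x n₁ ≫ F'.map q := by
    simp only [map_comp', MonoidalLeftAction.actionHomRight_comp, Category.assoc]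
    rw [μₗ_naturality_right_assoc, μₗ_associativity_assoc]
  have hα : ∀ {a b : C} {n n' : M₃} (g : n ⟶ n') {n'' : M₃} (h : a ⊙ₗ b ⊙ₗ n' ⟶ n''),
      (a ⊗ b) ⊴ₗ g ≫ (αₗ a b n').hom ≫ h = (αₗ a b n).hom ≫ a ⊴ₗ b ⊴ₗ g ≫ h := by
    intros; simp
  -- The compatibility of `S.η` with the module functor constraints, solved for the passage of `x`
  -- into `G'`; it is the source of the braiding.
  have hη : x ⊴ₗ S.η n₁ ≫ μₗ G'.toFunctor x n₁ =
      (slide S.b x (F'.obj n₁)).inv ≫ S.x ⊴ₗ μₗ F'.toFunctor x n₁ ≫ S.η (x ⊙ₗ n₁) := by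
    rw [slide_inv, Category.assoc, Category.assoc, S.comm_right, Iso.inv_hom_id_assoc]
  have hs : ∀ {n n' : M₃} (g : n ⟶ n'), x ⊴ₗ S.x ⊴ₗ g ≫ (slide S.b x n').inv =
      (slide S.b x n).inv ≫ S.x ⊴ₗ x ⊴ₗ g := fun g => by
    rw [Iso.eq_inv_comp, ← Category.assoc, Iso.comp_inv_eq, slide_naturality_right]
  have key := middleExchange_action (S.b.β x).inv w z (F'.obj n₀)
  rw [hα, hα, hμ]
  generalize μₗ F'.toFunctor z n₀ ≫ F'.map s = g
  simp only [MonoidalLeftAction.actionHomRight_comp, Category.assoc] at key ⊢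
  rw [reassoc_of% key]
  simp only [← MonoidalLeftAction.actionHomRight_comp_assoc]
  refine congrArg (fun e => _ ≫ _ ≫ w ⊴ₗ e ≫ p) ?_
  simp only [MonoidalLeftAction.actionHomRight_comp, Category.assoc]
  rw [S.nat, reassoc_of% hη, reassoc_of% hs, slide_inv, Category.assoc, Category.assoc]

/-- The interchange law for module natural transformations. -/
lemma vcomp_modifiedHcomp {w x y z : Center C} {F G H : RexFunctor k C M₁ M₂}
    {F' G' H' : RexFunctor k C M₂ M₃} (p : w ⊙ₗ G' ⟶ H') (q : x ⊙ₗ G ⟶ H) (r : y ⊙ₗ F' ⟶ G')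
    (s : z ⊙ₗ F ⟶ G) :
    vcomp (modifiedHcomp p q) (modifiedHcomp r s) =
      middleBraiding w x y z ⊵ₗ comp F' F ≫ modifiedHcomp (vcomp p r) (vcomp q s) := by
  ext m
  have h := raw_interchange (CenterPair.ofHom y r) (app s m) (app q m) (app p (H.obj m))
  refine Eq.trans ?_ (h.trans ?_)
  · refine Eq.trans (b := (αₗ (w.1 ⊗ x.1) (y.1 ⊗ z.1) (F'.obj (F.obj m))).hom ≫
      (w.1 ⊗ x.1) ⊴ₗ app (modifiedHcomp r s) m ≫ app (modifiedHcomp p q) m) rfl ?_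
    rw [app_modifiedHcomp, app_modifiedHcomp]
    rfl
  · refine Eq.trans ?_ (b := (middleBraiding w x y z).f ⊵ₗ F'.obj (F.obj m) ≫
      app (modifiedHcomp (vcomp p r) (vcomp q s)) m) rfl
    rw [app_modifiedHcomp, middleBraiding_f]
    rfl

end RexFunctor

lemma verComp_ev (F G H : RexFunctor k C M₁ M₂) :
    verComp F G H ⊵ₗ F ≫ ev F H = RexFunctor.vcomp (ev G H) (ev F G) :=
  transpose_ev _

lemma horComp_ev (F G : RexFunctor k C M₁ M₂) (F' G' : RexFunctor k C M₂ M₃) :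
    horComp F' G' F G ⊵ₗ RexFunctor.comp F' F ≫ ev _ _ =
      RexFunctor.modifiedHcomp (ev F' G') (ev F G) :=
  transpose_ev _

lemma RexFunctor.tensorHom_vcomp {w w' y y' : Center C} {F G H : RexFunctor k C M₁ M₂}
    (f : w ⟶ w') (g : y ⟶ y') (p : w' ⊙ₗ G ⟶ H) (r : y' ⊙ₗ F ⟶ G) :
    (f ⊗ₘ g) ⊵ₗ F ≫ vcomp p r = vcomp (f ⊵ₗ G ≫ p) (g ⊵ₗ F ≫ r) := by
  have h := MonoidalLeftAction.actionAssocIso_hom_naturality f g (𝟙 F)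
  simp only [MonoidalLeftAction.actionHom_def, MonoidalLeftAction.actionHomRight_id,
    Category.comp_id] at h
  rw [vcomp, reassoc_of% h, vcomp, MonoidalLeftAction.actionHomRight_comp, Category.assoc,
    MonoidalLeftAction.action_exchange_assoc, MonoidalLeftAction.action_exchange_assoc]

end Interchange

end InternalNat

end

theorem mainTheorem7 {k : Type w} [Field k] [IsAlgClosed k]
    {C : Type u} [Category.{v} C] [Abelian C] [Linear k C] [MonoidalCategory C] [RigidCategory C]
    [InternalNat.FiniteTensorCategory k C]
    {M₁ : Type u₁} [Category.{v₁} M₁] [Abelian M₁] [Linear k M₁] [MonoidalLeftAction C M₁]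
    [InternalNat.FiniteModuleCategory k C M₁]
    {M₂ : Type u₂} [Category.{v₂} M₂] [Abelian M₂] [Linear k M₂] [MonoidalLeftAction C M₂]
    [InternalNat.FiniteModuleCategory k C M₂]
    {M₃ : Type u₃} [Category.{v₃} M₃] [Abelian M₃] [Linear k M₃] [MonoidalLeftAction C M₃]
    [InternalNat.FiniteModuleCategory k C M₃]
    (F G H : InternalNat.RexFunctor k C M₁ M₂) (F' G' H' : InternalNat.RexFunctor k C M₂ M₃) :
    (InternalNat.horComp G' H' G H ⊗ₘ InternalNat.horComp F' G' F G) ≫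
        InternalNat.verComp (InternalNat.RexFunctor.comp F' F) (InternalNat.RexFunctor.comp G' G)
          (InternalNat.RexFunctor.comp H' H) =
      InternalNat.middleBraiding (InternalNat.NatObj G' H') (InternalNat.NatObj G H)
          (InternalNat.NatObj F' G') (InternalNat.NatObj F G) ≫
        (InternalNat.verComp F' G' H' ⊗ₘ InternalNat.verComp F G H) ≫
          InternalNat.horComp F' H' F H := by
  apply InternalNat.intHom_ext
  rw [MonoidalLeftAction.comp_actionHomLeft, Category.assoc, InternalNat.verComp_ev,
    InternalNat.RexFunctor.tensorHom_vcomp, InternalNat.horComp_ev, InternalNat.horComp_ev,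
    InternalNat.RexFunctor.vcomp_modifiedHcomp, MonoidalLeftAction.comp_actionHomLeft,
    MonoidalLeftAction.comp_actionHomLeft, Category.assoc, Category.assoc, InternalNat.horComp_ev,
    ← InternalNat.RexFunctor.modifiedHcomp_dinatural, InternalNat.verComp_ev,
    InternalNat.verComp_ev]
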